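/- **Setting.** Let $(\Omega,\mathcal A,\mathbb P)$ be a probability space, $(E,\mathcal T)$ a measurable space, $X=(X_i)_{i\ge1}$ a stationary $E$-valued process, $T$ the shift on $E^{\mathbb N_+}$, and $d\ge1$. For each $n\ge1$ let $S_n\Phi:E^{\mathbb N_+}\to\mathbb R^d$ be measurable. Let $(k(n))_{n\ge1}$ be a non-decreasing sequence of positive integers. For $\lambda\in\mathbb R^d$ put $$\Lambda_n(\lambda)=\tfrac1n\log\mathbb E\,e^{\langle\lambda,S_n\Phi(X)\rangle}\in(-\infty,+\infty],\qquad \mu_n^\omega=\frac1{k(n)}\sum_{j=1}^{k(n)}\delta_{S_n\Phi(T^{(j-1)n}X(\omega))/n},\qquad \Lambda_n^\omega(\lambda)=\tfrac1n\log\int_{\mathbb R^d}e^{n\langle\lambda,x\rangle}\,d\mu_n^\omega(x).$$ For sub-$\sigma$-algebras $\mathcal U,\mathcal V$ let $\alpha(\mathcal U,\mathcal V)=\sup\{|\mathbb P(U)\mathbb P(V)-\mathbb P(U\cap V)|:U\in\mathcal U,V\in\mathcal V\}$, and for $m\ge1$ let $\alpha_{X,m}=\sup_{i\ge1}\alpha(\sigma(X_k:k\le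 i),\sigma(X_j:j\ge i+m))$. **Assumptions.** - (A1') There is a convex open set $\mathcal D\subset\mathbb R^d$ such that $\Lambda(\lambda)=\lim_n\Lambda_n(\lambda)$ exists and is finite for every $\lambda\in\mathcal D$. - (A2') There are $\gamma,\theta>0$ with $\alpha_{X,m}=O(\exp(-\gamma m^\theta))$ as $m\to\infty$. - (A3) There are measurable functions $S_n\Phi_n:E^{\mathbb N_+}\to\mathbb R^d$, each depending only on the first $2n$ coordinates, with $\|S_n\Phi-S_n\Phi_n\|_\infty/n\to0$, where $\|\cdot\|_\infty$ is the supremum over all of $E^{\mathbb N_+}$. - $\Lambda$ is of class $C^2$ on $\mathcal D$. **Notation.** Outside $\mathcal D$ put $\Lambda=\limsup_n\Lambda_n$, and let $\Lambda^*(x)=\sup_{\lambda\in\mathbb R^d}(\langle\lambda,x\rangle-\Lambda(\lambda))$. For $B\subset\mathcal D$ let $$\varLambda^*(B)=\sup_{\lambda\in B}\Lambda^*(\nabla\Lambda(\lambda)),\quad \xi_1(B)=\sup_{\lambda\in B}\|\nabla\Lambda(\lambda)\|,\quad \xi_2(B)=\sup_{\lambda\in B}\tfrac12\,{}^t\lambda\,D^2\Lambda(\lambda)\,\lambda,\quad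 \xi(B)=\varLambda^*(B)+\xi_2(B),$$ $$\delta_n\Lambda(B)=\sup_{\lambda\in B}|\Lambda(\lambda)-\Lambda_n(\lambda)|,\quad \delta_n\Phi(B)=\Big(\sup_{\lambda\in B}\|\lambda\|\Big)\frac{\|S_n\Phi-S_n\Phi_n\|_\infty}{n},\quad \delta_n(\Lambda,\Phi)(B)=\delta_n\Lambda(B)+\delta_n\Phi(B),$$ and let $B_\rho=\{\lambda\in\mathbb R^d:d(\lambda,B)\le\rho\}$ for the Euclidean distance. **Theorem 2.4.** Assume the above. Let $B\subset\mathcal D$ be compact and $\rho>0$ with $B_\rho\subset\mathcal D$, and suppose that $(\epsilon_n)_{n\ge1}$ is a positive sequence converging to $0$ such that $$\sum_{n\ge1}\exp\!\big(-\sqrt{\epsilon_n}\,[\log k(n)-n\varLambda^*(B)]\big)\,\epsilon_n^{-(d+3/2)}\exp\!\big(3n[\xi(B_\rho)\epsilon_n+\delta_n(\Lambda,\Phi)(B_\rho)]\big)<\infty.\tag{BC}$$ Then for every $\eta>0$, with probability $1$, for all sufficiently large $n$, $$\max_{\lambda\in B}|\Lambda_n^\omega(\lambda)-\Lambda(\lambda)|\le(\eta+2\xi_1(B))\,\epsilon_n+\delta_n\Lambda(B_\rho)+2\,\delta_n\Phi(B).$$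 If moreover $B$ consists of a single point, then with probability $1$, for all sufficiently large $n$, the same maximum is at most $$\frac{\epsilon_n(1+\epsilon_n)}{n}+\delta_n\Lambda(B_\rho)+2\,\delta_n\Phi(B).$$ -/

import Mathlib

open MeasureTheory Filter Topology
open scoped ENNReal

noncomputable section

namespace LocalFluct

section Mixing

variable {Ω : Type*} [MeasurableSpace Ω] {E : Type*} [mE : MeasurableSpace E]

/-- The strong mixing coefficient of two sub-σ-algebras,
`sup {|P(U) P(V) - P(U ∩ V)| : U ∈ 𝓤, V ∈ 𝓥}` (the supremum of a nonempty subset of `[0, 1]`). -/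
def alphaCoeff (P : Measure Ω) (𝓤 𝓥 : MeasurableSpace Ω) : ℝ :=
  sSup {r : ℝ | ∃ U V : Set Ω, MeasurableSet[𝓤] U ∧ MeasurableSet[𝓥] V ∧
    r = |P.real U * P.real V - P.real (U ∩ V)|}

/-- The mixing coefficients `α_{X,m}` of a process. The coordinates are numbered from `0`:
`X 0` is the first variable. -/
def alphaMix (P : Measure Ω) (X : ℕ → Ω → E) (m : ℕ) : ℝ :=
  if m = 0 then 1 / 2 else
    ⨆ i : ℕ, alphaCoeff P (⨆ k : {k : ℕ // k ≤ i}, mE.comap (X k))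
      (⨆ j : {j : ℕ // i + m ≤ j}, mE.comap (X j))

/-- `α_{X,m} = O(exp(-γ m^θ))` for some `γ, θ > 0`. -/
def StretchedExpMixing (P : Measure Ω) (X : ℕ → Ω → E) : Prop :=
  ∃ γ θ : ℝ, 0 < γ ∧ 0 < θ ∧
    (fun m : ℕ => alphaMix P X m) =O[atTop] (fun m : ℕ => Real.exp (-γ * (m : ℝ) ^ θ))

/-- The path of the process as a point of the sequence space. -/
def path (X : ℕ → Ω → E) (ω : Ω) : ℕ → E := fun i => X i ω

/-- (Strict) stationarity: the shifted process has the same law on the sequence space. -/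
def Stationary (P : Measure Ω) (X : ℕ → Ω → E) : Prop :=
  P.map (path fun i => X (i + 1)) = P.map (path X)

end Mixing

section Main

variable {Ω : Type*} [MeasurableSpace Ω] {E : Type*} [MeasurableSpace E] {d : ℕ}

/-- The `m`-th iterate `T^m` of the shift on sequences. -/
def shift (m : ℕ) (z : ℕ → E) : ℕ → E := fun i => z (i + m)

/-- `Λ_n(l) = (1/n) log 𝔼 exp⟨l, S_n(X)⟩`, with value `+∞` if the expectation is infinite. -/
def LambdaN (P : Measure Ω) (X : ℕ → Ω → E)
    (S : ℕ → (ℕ → E) → EuclideanSpace ℝ (Fin d)) (n : ℕ) (l : EuclideanSpace ℝ (Fin d)) : EReal :=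
  ENNReal.log (∫⁻ ω, ENNReal.ofReal (Real.exp (inner ℝ l (S n (path X ω)))) ∂P) / (n : EReal)

/-- `Λ(l)`. This is `lim Λ_n(l)` wherever that limit exists, in particular on the domain `𝒟` below.
(At a point without limit the upper limit is taken, a choice that does not affect
`Λ^*` at the gradients of `Λ` on `𝒟`, by convexity.) -/
def LambdaLim (P : Measure Ω) (X : ℕ → Ω → E)
    (S : ℕ → (ℕ → E) → EuclideanSpace ℝ (Fin d)) (l : EuclideanSpace ℝ (Fin d)) : EReal :=
  limsup (fun n : ℕ => LambdaN P X S n l) atTop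

/-- `Λ` as a real-valued function, for use where it is finite. -/
def LambdaReal (P : Measure Ω) (X : ℕ → Ω → E)
    (S : ℕ → (ℕ → E) → EuclideanSpace ℝ (Fin d)) (l : EuclideanSpace ℝ (Fin d)) : ℝ :=
  (LambdaLim P X S l).toReal

/-- `Λ(l) = lim Λ_n(l)` exists and is finite for each `l ∈ D`, where `D` is convex and open. -/
def HasFiniteLimitOn (P : Measure Ω) (X : ℕ → Ω → E)
    (S : ℕ → (ℕ → E) → EuclideanSpace ℝ (Fin d)) (D : Set (EuclideanSpace ℝ (Fin d))) : Prop :=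
  Convex ℝ D ∧ IsOpen D ∧
    ∀ l ∈ D, ∃ r : ℝ, Tendsto (fun n : ℕ => LambdaN P X S n l) atTop (𝓝 (r : EReal))

/-- `‖S_n - S'_n‖_∞ / n`. -/
def approxErr (S S' : ℕ → (ℕ → E) → EuclideanSpace ℝ (Fin d)) (n : ℕ) : ℝ≥0∞ :=
  (⨆ z : ℕ → E, ‖S n z - S' n z‖ₑ) / (n : ℝ≥0∞)

/-- Each `S'_n` (`n ≥ 1`) is a measurable function of the `2n` first coordinates only, and
`‖S_n - S'_n‖_∞ / n` tends to `0`. -/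
def LocalApprox (S S' : ℕ → (ℕ → E) → EuclideanSpace ℝ (Fin d)) : Prop :=
  (∀ n, 1 ≤ n → Measurable (S' n) ∧ DependsOn (S' n) (Set.Iio (2 * n))) ∧
    Tendsto (approxErr S S') atTop (𝓝 0)

/-- The empirical measure `μ_n^ω` of the `k(n)` points `S_n(T^{jn} X(ω)) / n`, `0 ≤ j < k(n)`. -/
def empMeasure (X : ℕ → Ω → E) (S : ℕ → (ℕ → E) → EuclideanSpace ℝ (Fin d)) (k : ℕ → ℕ)
    (n : ℕ) (ω : Ω) : Measure (EuclideanSpace ℝ (Fin d)) :=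
  (k n : ℝ≥0∞)⁻¹ • ∑ j ∈ Finset.range (k n),
    Measure.dirac ((n : ℝ)⁻¹ • S n (shift (j * n) (path X ω)))

/-- `Λ_n^ω(l) = (1/n) log ∫ exp(n⟨l, x⟩) dμ_n^ω(x)`. -/
def LambdaEmp (X : ℕ → Ω → E) (S : ℕ → (ℕ → E) → EuclideanSpace ℝ (Fin d)) (k : ℕ → ℕ)
    (n : ℕ) (ω : Ω) (l : EuclideanSpace ℝ (Fin d)) : ℝ :=
  (1 / (n : ℝ)) * Real.log (∫ x, Real.exp (n * inner ℝ l x) ∂(empMeasure X S k n ω))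

/-- The Fenchel-Legendre transform `Λ^*(x) = sup {⟨l, x⟩ - Λ(l) : l ∈ ℝ^d}`. -/
def LambdaStar (P : Measure Ω) (X : ℕ → Ω → E)
    (S : ℕ → (ℕ → E) → EuclideanSpace ℝ (Fin d)) (x : EuclideanSpace ℝ (Fin d)) : EReal :=
  ⨆ l : EuclideanSpace ℝ (Fin d), ((inner ℝ l x : ℝ) : EReal) - LambdaLim P X S l

/-- `sup {Λ^*(∇Λ(l)) : l ∈ B}`. -/
def LambdaStarSup (P : Measure Ω) (X : ℕ → Ω → E)
    (S : ℕ → (ℕ → E) → EuclideanSpace ℝ (Fin d)) (B : Set (EuclideanSpace ℝ (Fin d))) : EReal :=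
  ⨆ l ∈ B, LambdaStar P X S (gradient (LambdaReal P X S) l)

/-- `ξ₁(B) = sup {‖∇Λ(l)‖ : l ∈ B}`. -/
def xi1 (P : Measure Ω) (X : ℕ → Ω → E)
    (S : ℕ → (ℕ → E) → EuclideanSpace ℝ (Fin d)) (B : Set (EuclideanSpace ℝ (Fin d))) : ℝ≥0∞ :=
  ⨆ l ∈ B, ‖gradient (LambdaReal P X S) l‖ₑ

/-- `ξ₂(B) = sup {(1/2) D²Λ(l)(l, l) : l ∈ B}`. -/
def xi2 (P : Measure Ω) (X : ℕ → Ω → E)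
    (S : ℕ → (ℕ → E) → EuclideanSpace ℝ (Fin d)) (B : Set (EuclideanSpace ℝ (Fin d))) : EReal :=
  ⨆ l ∈ B, ((1 / 2 * fderiv ℝ (fderiv ℝ (LambdaReal P X S)) l l l : ℝ) : EReal)

/-- `ξ(B) = sup {Λ^*(∇Λ(l)) : l ∈ B} + ξ₂(B)`. -/
def xi (P : Measure Ω) (X : ℕ → Ω → E)
    (S : ℕ → (ℕ → E) → EuclideanSpace ℝ (Fin d)) (B : Set (EuclideanSpace ℝ (Fin d))) : EReal :=
  LambdaStarSup P X S B + xi2 P X S B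

/-- `δ_nΛ(B) = sup {|Λ(l) - Λ_n(l)| : l ∈ B}`. -/
def deltaLambda (P : Measure Ω) (X : ℕ → Ω → E)
    (S : ℕ → (ℕ → E) → EuclideanSpace ℝ (Fin d)) (B : Set (EuclideanSpace ℝ (Fin d)))
    (n : ℕ) : ℝ≥0∞ :=
  ⨆ l ∈ B, (LambdaLim P X S l - LambdaN P X S n l).abs

/-- `δ_nΦ(B) = (sup {‖l‖ : l ∈ B}) ‖S_n - S'_n‖_∞ / n`. -/
def deltaPhi (S S' : ℕ → (ℕ → E) → EuclideanSpace ℝ (Fin d))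
    (B : Set (EuclideanSpace ℝ (Fin d))) (n : ℕ) : ℝ≥0∞ :=
  (⨆ l ∈ B, ‖l‖ₑ) * approxErr S S' n

/-- `δ_n(Λ,Φ)(B) = δ_nΛ(B) + δ_nΦ(B)`. -/
def deltaTot (P : Measure Ω) (X : ℕ → Ω → E)
    (S S' : ℕ → (ℕ → E) → EuclideanSpace ℝ (Fin d)) (B : Set (EuclideanSpace ℝ (Fin d)))
    (n : ℕ) : ℝ≥0∞ :=
  deltaLambda P X S B n + deltaPhi S S' B n

/-- The `n`-th term of the series in the summability condition, with `Bρ` the closed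
`ρ`-neighbourhood of `B`:
`exp(-√ε_n [log k(n) - n sup_B Λ^*(∇Λ)]) ε_n^{-(d+3/2)} exp(3n[ξ(Bρ) ε_n + δ_n(Λ,Φ)(Bρ)])`. -/
def bcTerm (P : Measure Ω) (X : ℕ → Ω → E)
    (S S' : ℕ → (ℕ → E) → EuclideanSpace ℝ (Fin d)) (B Bρ : Set (EuclideanSpace ℝ (Fin d)))
    (k : ℕ → ℕ) (ε : ℕ → ℝ) (n : ℕ) : ℝ≥0∞ :=
  EReal.exp (-((Real.sqrt (ε n) : ℝ) : EReal) *
      (((Real.log (k n) : ℝ) : EReal) - (n : EReal) * LambdaStarSup P X S B)) *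
    ENNReal.ofReal (ε n ^ (-((d : ℝ) + 3 / 2))) *
    EReal.exp (3 * (n : EReal) *
      (xi P X S Bρ * ((ε n : ℝ) : EReal) + ((deltaTot P X S S' Bρ n : ℝ≥0∞) : EReal)))

end Main

end LocalFluct

end

open LocalFluct

/-! For fixed `l`, the blocks give variables `Y_j = exp⟨l, S'_n(T^{jn}X)⟩` that are identically
distributed by stationarity and nearly independent at index distance `q`, because `S'_n` sees only
`2n` coordinates. The empirical pressure of `S'` is `(1/n) log` of their average over `k(n)` blocks,
so everything rests on a weak law with a rate.

The law uses a moment of order `1 + τ` with `τ = √ε_n` (`measureReal_abs_average_sub_gt_le`):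
truncate, apply Chebyshev to the bounded part and Markov to the tail. The deviation probability is
governed by `(q/k)^τ ε^{-(1+τ)} 𝔼Y^{1+τ}/(𝔼Y)^{1+τ}`. The log of the moment ratio is about
`n[Λ((1+τ)l) - (1+τ)Λ(l)]`, and Taylor's formula turns the bracket into at most `τ Λ^*(∇Λ(l)) + τ²
ξ` (`moment_ratio_le`); since `τ² = ε_n`, this is the exponent in the summability condition.

That condition also pays for a net of about `ε_n^{-(d+1/4)}` points of `B` and for the factor `q^τ`,
where `q` is a power of `log k(n)` or bounded (`summable_of_bc`). Borel-Cantelli then controls the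
net (`ae_eventually_abs_lambdaEmp_sub_le`).

To pass from the net to `B`, both pressures are convex. Upper bounds at the vertices of a simplex
and a lower bound at its centre make them equi-Lipschitz near each point of `B`, hence along `B` by
compactness. With mesh `ε_n^{1+1/(4d)}` the Lipschitz error is `o(ε_n)`. For a single point no net
is needed, and the error of the logarithm remains. -/

namespace LocalFluct
open ProbabilityTheory

set_option linter.unusedSectionVars false

/-! ### Covariances under strong mixing. -/

section Covariance

variable {Ω : Type*} [MeasurableSpace Ω] {P : Measure Ω} [IsProbabilityMeasure P]

/-- The layer-cake representation of a function with values in `[0, M]`. -/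
theorem integral_indicator_lt_eq {M z : ℝ} (h0 : 0 ≤ z) (hM : z ≤ M) :
    ∫ s in Set.Ioc 0 M, (Set.Iio z).indicator (fun _ => (1 : ℝ)) s = z := by
  rw [integral_indicator measurableSet_Iio, Measure.restrict_restrict measurableSet_Iio,
    integral_const, smul_eq_mul, mul_one, Measure.real, Measure.restrict_apply_univ]
  have : Set.Iio z ∩ Set.Ioc 0 M = Set.Ioo 0 z := by
    ext s; simp only [Set.mem_inter_iff, Set.mem_Iio, Set.mem_Ioc, Set.mem_Ioo]
    constructor
    · rintro ⟨h, h', -⟩; exact ⟨h', h⟩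
    · rintro ⟨h', h⟩; exact ⟨h, h', by linarith⟩
  rw [this, Real.volume_Ioo, sub_zero, ENNReal.toReal_ofReal h0]

/-- The covariance of two variables with values in `[0, M]` is controlled by the dependence of
their superlevel sets. -/
theorem abs_integral_mul_sub_le {Z W : Ω → ℝ} (hZ : Measurable Z) (hW : Measurable W) {M a : ℝ}
    (hM : 0 ≤ M) (hZ0 : ∀ ω, 0 ≤ Z ω) (hZM : ∀ ω, Z ω ≤ M) (hW0 : ∀ ω, 0 ≤ W ω)
    (hWM : ∀ ω, W ω ≤ M)
    (h : ∀ s t : ℝ, |P.real (Z ⁻¹' Set.Ioi s) * P.real (W ⁻¹' Set.Ioi t) -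
      P.real (Z ⁻¹' Set.Ioi s ∩ W ⁻¹' Set.Ioi t)| ≤ a) :
    |∫ ω, Z ω * W ω ∂P - (∫ ω, Z ω ∂P) * ∫ ω, W ω ∂P| ≤ a * M ^ 2 := by
  set ν : Measure ℝ := volume.restrict (Set.Ioc 0 M) with hν
  have hνr : ν.real Set.univ = M := by
    simp [hν, Measure.real, hM]
  let I : ℝ → ℝ → ℝ := fun z s => (Set.Iio z).indicator (fun _ => (1 : ℝ)) s
  have hI : ∀ z s, I z s = if s < z then 1 else 0 := fun z s => by
    simp [I, Set.indicator_apply]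
  have hIm : Measurable (Function.uncurry I) := by
    have : Function.uncurry I = ({p : ℝ × ℝ | p.2 < p.1}).indicator (fun _ => (1 : ℝ)) := by
      ext ⟨z, s⟩; simp [I, Set.indicator_apply]
    rw [this]
    exact measurable_const.indicator (measurableSet_lt measurable_snd measurable_fst)
  have hI1 : ∀ z s, ‖I z s‖ ≤ 1 := fun z s => by rw [hI]; split_ifs <;> simp
  have hZr : ∀ ω, Z ω = ∫ s, I (Z ω) s ∂ν := fun ω =>
    (integral_indicator_lt_eq (hZ0 ω) (hZM ω)).symm
  have hWr : ∀ ω, W ω = ∫ s, I (W ω) s ∂ν := fun ω =>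
    (integral_indicator_lt_eq (hW0 ω) (hWM ω)).symm
  have hIZ : ∀ s, ∫ ω, I (Z ω) s ∂P = P.real (Z ⁻¹' Set.Ioi s) := fun s => by
    rw [← integral_indicator_one (hZ measurableSet_Ioi)]
    congr
  have hIW : ∀ s, ∫ ω, I (W ω) s ∂P = P.real (W ⁻¹' Set.Ioi s) := fun s => by
    rw [← integral_indicator_one (hW measurableSet_Ioi)]
    congr
  have hIZW : ∀ s t, ∫ ω, I (Z ω) s * I (W ω) t ∂P =
      P.real (Z ⁻¹' Set.Ioi s ∩ W ⁻¹' Set.Ioi t) := fun s t => by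
    rw [← integral_indicator_one ((hZ measurableSet_Ioi).inter (hW measurableSet_Ioi))]
    congr 1
    ext ω
    rw [Set.inter_indicator_one]
    rfl
  have hmZ : Measurable (Function.uncurry fun ω s => I (Z ω) s) :=
    hIm.comp ((hZ.comp measurable_fst).prodMk measurable_snd)
  have hmW : Measurable (Function.uncurry fun ω s => I (W ω) s) :=
    hIm.comp ((hW.comp measurable_fst).prodMk measurable_snd)
  have bdd : ∀ {α : Type _} [MeasurableSpace α] (κ : Measure α) [IsFiniteMeasure κ] (f : α → ℝ),
      Measurable f → (∀ x, ‖f x‖ ≤ 1) → Integrable f κ := fun κ _ f hf hb =>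
    Integrable.of_bound hf.aestronglyMeasurable 1 (Eventually.of_forall hb)
  have e1 : ∫ ω, Z ω ∂P = ∫ s, P.real (Z ⁻¹' Set.Ioi s) ∂ν := by
    simp_rw [← hIZ]
    rw [← integral_integral_swap (bdd _ _ hmZ (fun x => hI1 _ _))]
    exact integral_congr_ae (Eventually.of_forall hZr)
  have e2 : ∫ ω, W ω ∂P = ∫ s, P.real (W ⁻¹' Set.Ioi s) ∂ν := by
    simp_rw [← hIW]
    rw [← integral_integral_swap (bdd _ _ hmW (fun x => hI1 _ _))]
    exact integral_congr_ae (Eventually.of_forall hWr)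
  have hmZW : Measurable (Function.uncurry fun (ω : Ω) (z : ℝ × ℝ) => I (Z ω) z.1 * I (W ω) z.2) := by
    refine Measurable.mul
      (hIm.comp ((hZ.comp measurable_fst).prodMk (measurable_fst.comp measurable_snd)))
      (hIm.comp ((hW.comp measurable_fst).prodMk (measurable_snd.comp measurable_snd)))
  have hb2 : ∀ (z w s t : ℝ), ‖I z s * I w t‖ ≤ 1 := fun z w s t => by
    rw [norm_mul]; exact mul_le_one₀ (hI1 _ _) (norm_nonneg _) (hI1 _ _)
  have e3 : ∫ ω, Z ω * W ω ∂P =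
      ∫ z : ℝ × ℝ, P.real (Z ⁻¹' Set.Ioi z.1 ∩ W ⁻¹' Set.Ioi z.2) ∂(ν.prod ν) := by
    simp_rw [← hIZW]
    rw [← integral_integral_swap (bdd _ _ hmZW (fun x => hb2 _ _ _ _))]
    refine integral_congr_ae (Eventually.of_forall fun ω => ?_)
    simp only
    rw [integral_prod_mul (fun s => I (Z ω) s) (fun t => I (W ω) t), ← hZr, ← hWr]
  have int1 : Integrable (fun z : ℝ × ℝ => P.real (Z ⁻¹' Set.Ioi z.1 ∩ W ⁻¹' Set.Ioi z.2))
      (ν.prod ν) := by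
    simp_rw [← hIZW]
    exact (bdd (P.prod (ν.prod ν)) _ hmZW (fun x => hb2 _ _ _ _)).integral_prod_right
  have int2 : Integrable (fun z : ℝ × ℝ => P.real (Z ⁻¹' Set.Ioi z.1) * P.real (W ⁻¹' Set.Ioi z.2))
      (ν.prod ν) := by
    refine Integrable.mul_prod (f := fun s => P.real (Z ⁻¹' Set.Ioi s))
      (g := fun s => P.real (W ⁻¹' Set.Ioi s)) ?_ ?_
    · simp_rw [← hIZ]
      exact (bdd (P.prod ν) _ hmZ (fun x => hI1 _ _)).integral_prod_right
    · simp_rw [← hIW]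
      exact (bdd (P.prod ν) _ hmW (fun x => hI1 _ _)).integral_prod_right
  -- Hoeffding's identity: the covariance is the integral over `(0, M]²` of the dependence of
  -- superlevel sets, whence `a` times the area.
  rw [e1, e2, e3, ← integral_prod_mul, ← integral_sub int1 int2, ← Real.norm_eq_abs]
  refine (norm_integral_le_of_norm_le_const (C := a) (Eventually.of_forall fun z => ?_)).trans ?_
  · rw [Real.norm_eq_abs, abs_sub_comm]; exact h _ _
  · rw [← Set.univ_prod_univ, measureReal_prod_prod, hνr, sq]

end Covariance

/-! ### Variance of sums with a band of strong dependence. -/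

section Deviation

variable {Ω : Type*} [MeasurableSpace Ω] {P : Measure Ω} [IsProbabilityMeasure P]

/-- The variance of a sum of bounded variables with small covariances outside a band. -/
theorem variance_sum_le_of_band {Z : ℕ → Ω → ℝ} {M V c : ℝ} (hc : 0 ≤ c)
    (hZ : ∀ i, Measurable (Z i))
    (hZ0 : ∀ i ω, 0 ≤ Z i ω) (hZM : ∀ i ω, Z i ω ≤ M) (hV : ∀ i, ∫ ω, Z i ω ^ 2 ∂P ≤ V)
    {q : ℕ} (hcov : ∀ i j, i + q ≤ j →
      |∫ ω, Z i ω * Z j ω ∂P - (∫ ω, Z i ω ∂P) * ∫ ω, Z j ω ∂P| ≤ c) (k : ℕ) :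
    variance (∑ i ∈ Finset.range k, Z i) P ≤ 2 * k * q * V + (k : ℝ) ^ 2 * c := by
  have hL : ∀ i, MemLp (Z i) 2 P := fun i =>
    MemLp.of_bound (hZ i).aestronglyMeasurable M (Eventually.of_forall fun ω => by
      rw [Real.norm_eq_abs, abs_of_nonneg (hZ0 i ω)]; exact hZM i ω)
  have hint : ∀ i, Integrable (fun ω => Z i ω ^ 2) P := fun i => (hL i).integrable_sq
  have hV0 : 0 ≤ V := (integral_nonneg fun ω => sq_nonneg _).trans (hV 0)
  -- Since the means are nonnegative, the covariance is at most `𝔼 Z_i Z_j`, and `zw ≤ (z² + w²)/2`.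
  have hnear : ∀ i j, covariance (Z i) (Z j) P ≤ V := fun i j => by
    rw [covariance_eq_sub (hL i) (hL j)]
    have h1 : (0 : ℝ) ≤ (∫ ω, Z i ω ∂P) * ∫ ω, Z j ω ∂P :=
      mul_nonneg (integral_nonneg (hZ0 i)) (integral_nonneg (hZ0 j))
    have h2 : ∫ ω, (Z i * Z j) ω ∂P ≤ ∫ ω, (Z i ω ^ 2 / 2 + Z j ω ^ 2 / 2) ∂P := by
      refine integral_mono ((hL i).integrable_mul (hL j))
        (((hint i).div_const 2).add ((hint j).div_const 2)) fun ω => ?_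
      simp only [Pi.mul_apply]
      nlinarith [sq_nonneg (Z i ω - Z j ω)]
    rw [integral_add ((hint i).div_const 2) ((hint j).div_const 2), integral_div,
      integral_div] at h2
    linarith [hV i, hV j]
  have hfar : ∀ i j, i + q ≤ j ∨ j + q ≤ i → covariance (Z i) (Z j) P ≤ c := fun i j hij => by
    rcases hij with hij | hij
    · rw [covariance_eq_sub (hL i) (hL j)]
      exact (le_abs_self _).trans (hcov i j hij)
    · rw [covariance_comm, covariance_eq_sub (hL j) (hL i)]
      exact (le_abs_self _).trans (hcov j i hij)
  have hrow : ∀ i ∈ Finset.range k, ∑ j ∈ Finset.range k, covariance (Z i) (Z j) P ≤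
      2 * q * V + k * c := fun i _ => by
    have h1 : ∀ j ∈ Finset.range k, covariance (Z i) (Z j) P ≤
        (if j ∈ Finset.Ico (i - q) (i + q) then V else 0) + c := fun j _ => by
      split_ifs with hj
      · linarith [hnear i j]
      · rw [zero_add]
        refine hfar i j ?_
        rw [Finset.mem_Ico] at hj
        omega
    refine (Finset.sum_le_sum h1).trans ?_
    rw [Finset.sum_add_distrib, Finset.sum_const, Finset.card_range, nsmul_eq_mul]
    gcongr
    rw [Finset.sum_ite_mem, Finset.sum_const, nsmul_eq_mul]
    gcongr
    have : (Finset.range k ∩ Finset.Ico (i - q) (i + q)).card ≤ 2 * q := by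
      refine (Finset.card_le_card Finset.inter_subset_right).trans ?_
      rw [Nat.card_Ico]; omega
    exact_mod_cast this
  rw [variance_sum' fun i _ => hL i]
  refine (Finset.sum_le_sum hrow).trans (le_of_eq ?_)
  rw [Finset.sum_const, Finset.card_range, nsmul_eq_mul]
  ring

end Deviation

/-! ### A weak law with rate from a moment of order `1 + τ`. -/

section Deviation

variable {Ω : Type*} [MeasurableSpace Ω] {P : Measure Ω} [IsProbabilityMeasure P]

/-- A weak law with rate, under a moment of order `1 + τ`, for identically distributed nonnegative
variables that are nearly independent when their indices are at distance at least `q`. -/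
theorem measureReal_abs_average_sub_gt_le {Y : ℕ → Ω → ℝ} (hY : ∀ i, Measurable (Y i))
    (hY0 : ∀ i ω, 0 ≤ Y i ω) (hid : ∀ i, IdentDistrib (Y i) (Y 0) P P) {k q : ℕ} (hk : 1 ≤ k)
    (hq : 1 ≤ q) {τ ε a : ℝ} (hτ : 0 < τ) (hτ1 : τ ≤ 1) (hε : 0 < ε)
    (hp : Integrable (fun ω => Y 0 ω ^ (1 + τ)) P) (hint : Integrable (Y 0) P)
    (hpos : 0 < ∫ ω, Y 0 ω ∂P)
    (hmix : ∀ i j, i + q ≤ j → ∀ A B : Set ℝ, MeasurableSet A → MeasurableSet B →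
      |P.real (Y i ⁻¹' A) * P.real (Y j ⁻¹' B) - P.real (Y i ⁻¹' A ∩ Y j ⁻¹' B)| ≤ a) :
    P.real {ω | ε * ∫ ω, Y 0 ω ∂P <
        |(k : ℝ)⁻¹ * ∑ i ∈ Finset.range k, Y i ω - ∫ ω, Y 0 ω ∂P|} ≤
      21 * (((q : ℝ) / k) ^ τ * ε ^ (-(1 + τ)) *
        ((∫ ω, Y 0 ω ^ (1 + τ) ∂P) / (∫ ω, Y 0 ω ∂P) ^ (1 + τ))) +
      9 * (a * (k : ℝ) ^ 2 / (q : ℝ) ^ 2) := by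
  set e := ∫ ω, Y 0 ω ∂P with he
  set mp := ∫ ω, Y 0 ω ^ (1 + τ) ∂P with hmp
  have hk0 : (0 : ℝ) < k := by exact_mod_cast hk
  have hq0 : (0 : ℝ) < q := by exact_mod_cast hq
  have ha0 : 0 ≤ a := (abs_nonneg _).trans
    (hmix 0 (0 + q) le_rfl ∅ ∅ MeasurableSet.empty MeasurableSet.empty)
  have hmp0 : 0 ≤ mp := integral_nonneg fun ω => Real.rpow_nonneg (hY0 0 ω) _
  -- The truncation level balances the two errors: the tail has mean at most `R ε e`, and the
  -- Chebyshev term is also of order `R`.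
  set M : ℝ := k * ε * e / q with hM
  have hM0 : 0 < M := by positivity
  set R := ((q : ℝ) / k) ^ τ * ε ^ (-(1 + τ)) * (mp / e ^ (1 + τ)) with hR
  have hR' : M ^ (-τ) * mp = R * (ε * e) := by
    have h1 : M ^ (-τ) = ((q : ℝ) / k) ^ τ * (ε * e) ^ (-τ) := by
      rw [show M = ((q : ℝ) / k)⁻¹ * (ε * e) by rw [hM]; field_simp,
        Real.mul_rpow (by positivity) (by positivity), Real.inv_rpow (by positivity),
        Real.rpow_neg (by positivity), inv_inv]
    rw [h1, hR, Real.rpow_neg hε.le, Real.rpow_add hε, Real.rpow_add hpos, Real.rpow_one,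
      Real.rpow_one, Real.rpow_neg (by positivity), Real.mul_rpow hε.le hpos.le]
    have := Real.rpow_pos_of_pos hε τ
    have := Real.rpow_pos_of_pos hpos τ
    field_simp
  have hR0 : 0 ≤ R := by positivity
  let φ : ℝ → ℝ := fun y => if y ≤ M then y else 0
  let ψ : ℝ → ℝ := fun y => if y ≤ M then 0 else y
  have hφm : Measurable φ := Measurable.ite measurableSet_Iic measurable_id measurable_const
  have hψm : Measurable ψ := Measurable.ite measurableSet_Iic measurable_const measurable_id
  have hφψ : ∀ y, y = φ y + ψ y := fun y => by simp only [φ, ψ]; split_ifs <;> simp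
  have hφ0 : ∀ y, 0 ≤ y → 0 ≤ φ y := fun y hy => by simp only [φ]; split_ifs <;> simp [hy]
  have hψ0 : ∀ y, 0 ≤ y → 0 ≤ ψ y := fun y hy => by simp only [ψ]; split_ifs <;> simp [hy]
  have hφM : ∀ y, φ y ≤ M := fun y => by
    simp only [φ]; split_ifs with h
    · exact h
    · exact hM0.le
  have hφsq : ∀ y, 0 ≤ y → φ y ^ 2 ≤ M ^ (1 - τ) * y ^ (1 + τ) := fun y hy => by
    simp only [φ]; split_ifs with h
    · calc y ^ 2 = y ^ (1 - τ) * y ^ (1 + τ) := by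
            rw [← Real.rpow_add_of_nonneg hy (by linarith) (by linarith), ← Real.rpow_natCast]
            congr 1; push_cast; ring
        _ ≤ _ := by gcongr
    · rw [zero_pow two_ne_zero]; positivity
  have hψle : ∀ y, 0 ≤ y → ψ y ≤ M ^ (-τ) * y ^ (1 + τ) := fun y hy => by
    simp only [ψ]; split_ifs with h
    · positivity
    · push Not at h
      have hy' : 0 < y := hM0.trans h
      calc y = y ^ (-τ) * y ^ (1 + τ) := by
            rw [← Real.rpow_add hy']; simp
        _ ≤ _ := by
            gcongr ?_ * _
            exact Real.rpow_le_rpow_of_nonpos hM0 h.le (by linarith)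
  have hψint0 : Integrable (fun ω => ψ (Y 0 ω)) P :=
    (hp.const_mul (M ^ (-τ))).mono' (hψm.comp (hY 0)).aestronglyMeasurable
      (Eventually.of_forall fun ω => by
        rw [Real.norm_eq_abs, abs_of_nonneg (hψ0 _ (hY0 0 ω))]; exact hψle _ (hY0 0 ω))
  have hψintle : ∫ ω, ψ (Y 0 ω) ∂P ≤ R * (ε * e) := by
    rw [← hR', ← integral_const_mul]
    exact integral_mono hψint0 (hp.const_mul _) fun ω => hψle _ (hY0 0 ω)
  have hφint0 : Integrable (fun ω => φ (Y 0 ω)) P :=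
    (hint.sub hψint0).congr (Eventually.of_forall fun ω => by
      simp only [Pi.sub_apply]; linarith [hφψ (Y 0 ω)])
  have hφsqint : ∫ ω, φ (Y 0 ω) ^ 2 ∂P ≤ M ^ (1 - τ) * mp := by
    rw [← integral_const_mul]
    refine integral_mono_of_nonneg (Eventually.of_forall fun ω => sq_nonneg _) (hp.const_mul _)
      (Eventually.of_forall fun ω => hφsq _ (hY0 0 ω))
  have hidφ : ∀ i, IdentDistrib (fun ω => φ (Y i ω)) (fun ω => φ (Y 0 ω)) P P := fun i =>
    (hid i).comp hφm
  have hidψ : ∀ i, IdentDistrib (fun ω => ψ (Y i ω)) (fun ω => ψ (Y 0 ω)) P P := fun i =>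
    (hid i).comp hψm
  have hψint : ∀ i, Integrable (fun ω => ψ (Y i ω)) P := fun i =>
    (hidψ i).integrable_iff.2 hψint0
  have hesum : e = (∫ ω, φ (Y 0 ω) ∂P) + ∫ ω, ψ (Y 0 ω) ∂P := by
    rw [← integral_add hφint0 hψint0, he]
    exact integral_congr_ae (Eventually.of_forall fun ω => hφψ _)
  -- If `R ≥ 1/3` the claimed bound exceeds `1`. Otherwise the mean of the tail is at most `ε e /
  -- 3`, as needed for the split into thirds below.
  by_cases hbig : 1 ≤ 3 * R
  · refine measureReal_le_one.trans ?_
    have : 0 ≤ a * (k : ℝ) ^ 2 / (q : ℝ) ^ 2 := by positivity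
    linarith
  push Not at hbig
  -- A third of the allowed deviation of the sum goes to each of: fluctuation of the truncated part,
  -- sum of the tails, mean of the tails.
  set c : ℝ := k * (ε * e) / 3 with hc
  have hc0 : 0 < c := by positivity
  have hvar : variance (∑ i ∈ Finset.range k, fun ω => φ (Y i ω)) P ≤
      2 * k * q * (M ^ (1 - τ) * mp) + (k : ℝ) ^ 2 * (a * M ^ 2) := by
    refine variance_sum_le_of_band (by positivity) (fun i => hφm.comp (hY i))
      (fun i ω => hφ0 _ (hY0 i ω)) (fun i ω => hφM _) (fun i => ?_) (q := q) (fun i j hij => ?_) k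
    · have := ((hidφ i).comp (measurable_id.pow_const 2)).integral_eq
      simp only [Function.comp_def, id] at this
      exact this.le.trans hφsqint
    · refine abs_integral_mul_sub_le (hφm.comp (hY i)) (hφm.comp (hY j)) hM0.le
        (fun ω => hφ0 _ (hY0 i ω)) (fun ω => hφM _) (fun ω => hφ0 _ (hY0 j ω)) (fun ω => hφM _)
        fun s t => ?_
      exact hmix i j hij (φ ⁻¹' Set.Ioi s) (φ ⁻¹' Set.Ioi t) (hφm measurableSet_Ioi)
        (hφm measurableSet_Ioi)
  have hmem : MemLp (∑ i ∈ Finset.range k, fun ω => φ (Y i ω)) 2 P :=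
    memLp_finsetSum' _ fun i _ =>
      MemLp.of_bound (hφm.comp (hY i)).aestronglyMeasurable M (Eventually.of_forall fun ω => by
        rw [Real.norm_eq_abs, abs_of_nonneg (hφ0 _ (hY0 i ω))]; exact hφM _)
  have hmean : ∫ ω, (∑ i ∈ Finset.range k, fun ω => φ (Y i ω)) ω ∂P =
      k * ∫ ω, φ (Y 0 ω) ∂P := by
    simp only [Finset.sum_apply]
    rw [integral_finsetSum _ fun i _ => (hidφ i).integrable_iff.2 hφint0,
      Finset.sum_congr rfl fun i _ => (hidφ i).integral_eq, Finset.sum_const, Finset.card_range,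
      nsmul_eq_mul]
  set A : Set Ω := {ω | c ≤ |(∑ i ∈ Finset.range k, fun ω => φ (Y i ω)) ω -
    ∫ ω, (∑ i ∈ Finset.range k, fun ω => φ (Y i ω)) ω ∂P|} with hA
  set C : Set Ω := {ω | c ≤ ∑ i ∈ Finset.range k, ψ (Y i ω)} with hC
  have hPA : P.real A ≤ 18 * R + 9 * (a * (k : ℝ) ^ 2 / (q : ℝ) ^ 2) := by
    have h1 : P.real A ≤ variance (∑ i ∈ Finset.range k, fun ω => φ (Y i ω)) P / c ^ 2 := by
      refine ENNReal.toReal_le_of_le_ofReal (div_nonneg (variance_nonneg _ _) (sq_nonneg _)) ?_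
      exact meas_ge_le_variance_div_sq hmem hc0
    refine h1.trans ((div_le_div_of_nonneg_right hvar (sq_nonneg _)).trans (le_of_eq ?_))
    have h2 : M ^ (1 - τ) * mp = M * (R * (ε * e)) := by
      rw [← hR', sub_eq_add_neg, Real.rpow_add hM0, Real.rpow_one]; ring
    rw [h2, hc, hM]
    field_simp
    ring
  have hPC : P.real C ≤ 3 * R := by
    have h1 := mul_meas_ge_le_integral_of_nonneg (μ := P)
      (f := fun ω => ∑ i ∈ Finset.range k, ψ (Y i ω))
      (Eventually.of_forall fun ω => Finset.sum_nonneg fun i _ => hψ0 _ (hY0 i ω))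
      (integrable_finsetSum _ fun i _ => hψint i) c
    rw [integral_finsetSum _ fun i _ => hψint i,
      Finset.sum_congr rfl fun i _ => (hidψ i).integral_eq, Finset.sum_const, Finset.card_range,
      nsmul_eq_mul] at h1
    have h2 : c * P.real C ≤ c * (3 * R) := by
      refine h1.trans ((mul_le_mul_of_nonneg_left hψintle hk0.le).trans (le_of_eq ?_))
      rw [hc]; ring
    exact le_of_mul_le_mul_left h2 hc0
  have hsub : {ω | ε * e < |(k : ℝ)⁻¹ * ∑ i ∈ Finset.range k, Y i ω - e|} ⊆ A ∪ C := by
    intro ω hω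
    simp only [Set.mem_ofPred_eq] at hω
    by_contra hcon
    simp only [hA, hC, Set.mem_union, Set.mem_ofPred_eq, not_or, not_le] at hcon
    obtain ⟨h1, h2⟩ := hcon
    rw [hmean, Finset.sum_apply] at h1
    have h3 : 0 ≤ ∑ i ∈ Finset.range k, ψ (Y i ω) :=
      Finset.sum_nonneg fun i _ => hψ0 _ (hY0 i ω)
    have h4 : ∑ i ∈ Finset.range k, Y i ω =
        ∑ i ∈ Finset.range k, φ (Y i ω) + ∑ i ∈ Finset.range k, ψ (Y i ω) := by
      rw [← Finset.sum_add_distrib]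
      exact Finset.sum_congr rfl fun i _ => hφψ _
    have h5 : 0 ≤ ∫ ω, ψ (Y 0 ω) ∂P := integral_nonneg fun ω => hψ0 _ (hY0 0 ω)
    have h6 : k * ∫ ω, ψ (Y 0 ω) ∂P ≤ c := by
      rw [hc, mul_div_assoc]
      have : 0 ≤ ε * e := by positivity
      refine mul_le_mul_of_nonneg_left ?_ hk0.le
      nlinarith
    have h7 : (k : ℝ)⁻¹ * ∑ i ∈ Finset.range k, Y i ω - e =
        (k : ℝ)⁻¹ * ((∑ i ∈ Finset.range k, φ (Y i ω) - k * ∫ ω, φ (Y 0 ω) ∂P) +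
          (∑ i ∈ Finset.range k, ψ (Y i ω) - k * ∫ ω, ψ (Y 0 ω) ∂P)) := by
      rw [h4, hesum]; field_simp; ring
    rw [h7, abs_mul, abs_of_pos (inv_pos.2 hk0), lt_inv_mul_iff₀ hk0] at hω
    have h8 : |∑ i ∈ Finset.range k, ψ (Y i ω) - k * ∫ ω, ψ (Y 0 ω) ∂P| ≤ c := by
      rw [abs_le]
      constructor
      · linarith
      · nlinarith
    have h9 := abs_add_le (∑ i ∈ Finset.range k, φ (Y i ω) - k * ∫ ω, φ (Y 0 ω) ∂P)
      (∑ i ∈ Finset.range k, ψ (Y i ω) - k * ∫ ω, ψ (Y 0 ω) ∂P)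
    have h10 : (k : ℝ) * (ε * e) = 3 * c := by rw [hc]; ring
    linarith
  calc _ ≤ P.real (A ∪ C) := measureReal_mono hsub
    _ ≤ P.real A + P.real C := measureReal_union_le _ _
    _ ≤ _ := by linarith

end Deviation

/-! ### Convexity of log-Laplace transforms. -/

section Convexity

variable {F : Type*} [NormedAddCommGroup F] [InnerProductSpace ℝ F]

/-- Hölder's inequality: the logarithm of a Laplace transform is convex where it is finite. -/
theorem convexOn_log_integral_exp {α : Type*} [MeasurableSpace α] {μ : Measure α} [NeZero μ]
    {V : α → F} {s : Set F} (hs : Convex ℝ s)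
    (hint : ∀ l ∈ s, Integrable (fun x => Real.exp (inner ℝ l (V x))) μ) :
    ConvexOn ℝ s fun l => Real.log (∫ x, Real.exp (inner ℝ l (V x)) ∂μ) := by
  refine ⟨hs, fun x hx y hy a b ha hb hab => ?_⟩
  have hpos : ∀ l ∈ s, 0 < ∫ x, Real.exp (inner ℝ l (V x)) ∂μ := fun l hl =>
    integral_exp_pos (hint l hl)
  -- The endpoints are treated apart because the Hölder exponents `1/a` and `1/b` need positive
  -- weights.
  rcases ha.eq_or_lt with rfl | ha
  · obtain rfl : b = 1 := by linarith
    simp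
  rcases hb.eq_or_lt with rfl | hb
  · obtain rfl : a = 1 := by linarith
    simp
  have hz := hs hx hy ha.le hb.le hab
  have hconj : (1 / a).HolderConjugate (1 / b) := by
    rw [Real.holderConjugate_iff]
    refine ⟨by rw [lt_div_iff₀ ha]; linarith, by simpa using hab⟩
  have key := integral_mul_le_Lp_mul_Lq_of_nonneg hconj (μ := μ)
    (f := fun z => Real.exp (a * inner ℝ x (V z))) (g := fun z => Real.exp (b * inner ℝ y (V z)))
    (Eventually.of_forall fun z => (Real.exp_pos _).le)
    (Eventually.of_forall fun z => (Real.exp_pos _).le) ?_ ?_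
  · have e1 : ∀ z, Real.exp (a * inner ℝ x (V z)) * Real.exp (b * inner ℝ y (V z)) =
        Real.exp (inner ℝ (a • x + b • y) (V z)) := fun z => by
      rw [← Real.exp_add, inner_add_left, real_inner_smul_left, real_inner_smul_left]
    have e2 : ∀ z, Real.exp (a * inner ℝ x (V z)) ^ (1 / a) = Real.exp (inner ℝ x (V z)) :=
      fun z => by rw [← Real.exp_mul]; congr 1; field_simp
    have e3 : ∀ z, Real.exp (b * inner ℝ y (V z)) ^ (1 / b) = Real.exp (inner ℝ y (V z)) :=
      fun z => by rw [← Real.exp_mul]; congr 1; field_simp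
    simp only [e1, e2, e3, one_div_one_div] at key
    have h := Real.log_le_log (hpos _ hz) key
    rwa [Real.log_mul (Real.rpow_pos_of_pos (hpos x hx) _).ne'
      (Real.rpow_pos_of_pos (hpos y hy) _).ne', Real.log_rpow (hpos x hx),
      Real.log_rpow (hpos y hy)] at h
  · have hm : AEStronglyMeasurable (fun z => Real.exp (a * inner ℝ x (V z))) μ := by
      have := ((hint x hx).aestronglyMeasurable.aemeasurable.pow_const a).aestronglyMeasurable
      refine this.congr (Eventually.of_forall fun z => ?_)
      simp only
      rw [← Real.exp_mul, mul_comm]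
    rw [← integrable_norm_rpow_iff hm (by simp [ha]) ENNReal.ofReal_ne_top]
    refine (hint x hx).congr (Eventually.of_forall fun z => ?_)
    simp only
    rw [Real.norm_eq_abs, Real.abs_exp, ENNReal.toReal_ofReal (by positivity), ← Real.exp_mul]
    congr 1; field_simp
  · have hm : AEStronglyMeasurable (fun z => Real.exp (b * inner ℝ y (V z))) μ := by
      have := ((hint y hy).aestronglyMeasurable.aemeasurable.pow_const b).aestronglyMeasurable
      refine this.congr (Eventually.of_forall fun z => ?_)
      simp only
      rw [← Real.exp_mul, mul_comm]
    rw [← integrable_norm_rpow_iff hm (by simp [hb]) ENNReal.ofReal_ne_top]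
    refine (hint y hy).congr (Eventually.of_forall fun z => ?_)
    simp only
    rw [Real.norm_eq_abs, Real.abs_exp, ENNReal.toReal_ofReal (by positivity), ← Real.exp_mul]
    congr 1; field_simp

end Convexity

/-! ### Second-order calculus along segments. -/

section Calculus

variable {F : Type*} [NormedAddCommGroup F] [NormedSpace ℝ F] {f : F → ℝ} {D : Set F}

theorem hasDerivAt_line (hD : IsOpen D) (hf : ContDiffOn ℝ 2 f D) {l v : F} {t : ℝ}
    (ht : l + t • v ∈ D) :
    HasDerivAt (fun t : ℝ => f (l + t • v)) (fderiv ℝ f (l + t • v) v) t := by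
  have h1 : HasFDerivAt f (fderiv ℝ f (l + t • v)) (l + t • v) :=
    ((hf.contDiffAt (hD.mem_nhds ht)).differentiableAt (by norm_num)).hasFDerivAt
  have h2 : HasDerivAt (fun t : ℝ => l + t • v) v t := by
    simpa using ((hasDerivAt_id t).smul_const v).const_add l
  exact h1.comp_hasDerivAt t h2

theorem hasDerivAt_fderiv_line (hD : IsOpen D) (hf : ContDiffOn ℝ 2 f D) {l v : F} {t : ℝ}
    (ht : l + t • v ∈ D) :
    HasDerivAt (fun t : ℝ => fderiv ℝ f (l + t • v) v)
      (fderiv ℝ (fderiv ℝ f) (l + t • v) v v) t := by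
  have h0 : ContDiffAt ℝ 1 (fderiv ℝ f) (l + t • v) :=
    (hf.contDiffAt (hD.mem_nhds ht)).fderiv_right (by norm_num)
  have h1 : HasFDerivAt (fderiv ℝ f) (fderiv ℝ (fderiv ℝ f) (l + t • v)) (l + t • v) :=
    (h0.differentiableAt (by norm_num)).hasFDerivAt
  have h2 : HasDerivAt (fun t : ℝ => l + t • v) v t := by
    simpa using ((hasDerivAt_id t).smul_const v).const_add l
  have h3 := h1.comp_hasDerivAt t h2
  simpa using h3.clm_apply (hasDerivAt_const t v)

/-- Second-order Taylor upper bound along a segment. -/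
theorem le_taylor_of_fderiv_le (hD : IsOpen D) (hf : ContDiffOn ℝ 2 f D) {l v : F} {τ c : ℝ}
    (hτ : 0 ≤ τ) (hseg : ∀ t ∈ Set.Icc 0 τ, l + t • v ∈ D)
    (hc : ∀ t ∈ Set.Icc 0 τ, fderiv ℝ (fderiv ℝ f) (l + t • v) v v ≤ 2 * c) :
    f (l + τ • v) ≤ f l + τ * fderiv ℝ f l v + τ ^ 2 * c := by
  have h1 : ∀ t ∈ Set.Icc 0 τ, fderiv ℝ f (l + t • v) v ≤ fderiv ℝ f l v + 2 * c * t := by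
    refine image_le_of_deriv_right_le_deriv_boundary
      (f' := fun t => fderiv ℝ (fderiv ℝ f) (l + t • v) v v) (B' := fun _ => 2 * c)
      (fun t ht => (hasDerivAt_fderiv_line hD hf (hseg t ht)).continuousAt.continuousWithinAt)
      (fun t ht => (hasDerivAt_fderiv_line hD hf
        (hseg t (Set.Ico_subset_Icc_self ht))).hasDerivWithinAt) (by simp) ?_ ?_ ?_
    · fun_prop
    · intro t ht
      have : HasDerivAt (fun t : ℝ => fderiv ℝ f l v + 2 * c * t) (2 * c) t := by
        simpa using ((hasDerivAt_id t).const_mul (2 * c)).const_add (fderiv ℝ f l v)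
      exact this.hasDerivWithinAt
    · exact fun t ht => hc t (Set.Ico_subset_Icc_self ht)
  have h2 : ∀ t ∈ Set.Icc 0 τ, f (l + t • v) ≤ f l + t * fderiv ℝ f l v + t ^ 2 * c := by
    refine image_le_of_deriv_right_le_deriv_boundary
      (f' := fun t => fderiv ℝ f (l + t • v) v) (B' := fun t => fderiv ℝ f l v + 2 * c * t)
      (fun t ht => (hasDerivAt_line hD hf (hseg t ht)).continuousAt.continuousWithinAt)
      (fun t ht => (hasDerivAt_line hD hf
        (hseg t (Set.Ico_subset_Icc_self ht))).hasDerivWithinAt) (by simp) ?_ ?_ ?_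
    · fun_prop
    · intro t ht
      have : HasDerivAt (fun t : ℝ => f l + t * fderiv ℝ f l v + t ^ 2 * c)
          (fderiv ℝ f l v + 2 * c * t) t := by
        have h := (((hasDerivAt_id t).mul_const (fderiv ℝ f l v)).const_add (f l)).add
          (((hasDerivAt_id t).pow 2).mul_const c)
        refine (h.congr_deriv ?_)
        simp; ring
      exact this.hasDerivWithinAt
    · exact fun t ht => h1 t (Set.Ico_subset_Icc_self ht)
  exact h2 τ ⟨hτ, le_rfl⟩

/-- The second derivative of a convex function is nonnegative. -/
theorem fderiv_fderiv_nonneg_of_convexOn (hD : IsOpen D) (hf : ContDiffOn ℝ 2 f D)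
    (hconv : ConvexOn ℝ D f) {l : F} (hl : l ∈ D) (v : F) :
    0 ≤ fderiv ℝ (fderiv ℝ f) l v v := by
  set g : ℝ →ᵃ[ℝ] F := AffineMap.lineMap l (l + v) with hg
  have hgt : ∀ t : ℝ, g t = l + t • v := fun t => by
    simp [hg, AffineMap.lineMap_apply, add_comm]
  set I : Set ℝ := g ⁻¹' D with hI
  have hIo : IsOpen I := by
    have : Continuous g := by
      have : (g : ℝ → F) = fun t => l + t • v := funext hgt
      rw [this]; fun_prop
    exact hD.preimage this
  have h0 : (0 : ℝ) ∈ I := by simp [hI, hgt, hl]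
  have hcI : ConvexOn ℝ I (f ∘ g) := hconv.comp_affineMap g
  have hfg : f ∘ g = fun t => f (l + t • v) := funext fun t => by simp [hgt]
  have hder : ∀ t ∈ I, HasDerivAt (f ∘ g) (fderiv ℝ f (l + t • v) v) t := fun t ht => by
    rw [hfg]; exact hasDerivAt_line hD hf (by rw [← hgt]; exact ht)
  have hmono : MonotoneOn (fun t : ℝ => fderiv ℝ f (l + t • v) v) I :=
    (hcI.monotoneOn_deriv fun t ht => (hder t ht).differentiableAt).congr
      fun t ht => (hder t ht).deriv
  have h2 : HasDerivAt (fun t : ℝ => fderiv ℝ f (l + t • v) v)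
      (fderiv ℝ (fderiv ℝ f) l v v) 0 := by
    have := hasDerivAt_fderiv_line (l := l) (v := v) (t := 0) hD hf (by simpa using hl)
    simpa using this
  have h3 := hmono.derivWithin_nonneg (x := 0)
  rwa [derivWithin_of_isOpen hIo h0, h2.deriv] at h3

end Calculus

/-! ### Finite nets in bounded subsets of `ℝ^d`. -/

section Net

/-- A bounded subset of `ℝ^d` contains a finite `r`-net with at most `C r^{-d}` points. -/
theorem exists_finset_net {d : ℕ} {B : Set (EuclideanSpace ℝ (Fin d))}
    (hB : Bornology.IsBounded B) :
    ∃ C : ℝ, 0 < C ∧ ∀ r : ℝ, 0 < r → r ≤ 1 → ∃ N : Finset (EuclideanSpace ℝ (Fin d)),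
      (N : Set (EuclideanSpace ℝ (Fin d))) ⊆ B ∧ (N.card : ℝ) ≤ C * r ^ (-(d : ℝ)) ∧
        ∀ x ∈ B, ∃ y ∈ N, dist x y ≤ r := by
  classical
  obtain ⟨R, hR0, hR⟩ := hB.exists_pos_norm_le
  -- Cubes of side `r / w` have diameter at most `r`; the `+ 1` keeps `w` positive when `d = 0`.
  set w : ℝ := Real.sqrt d + 1 with hw
  have hw1 : 1 ≤ w := by have := Real.sqrt_nonneg (d : ℝ); linarith
  have hw0 : 0 < w := by linarith
  refine ⟨(2 * R * w + 3) ^ d, by positivity, fun r hr hr1 => ?_⟩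
  let cell : EuclideanSpace ℝ (Fin d) → Fin d → ℤ := fun x i => ⌊x i / (r / w)⌋
  have hh : 0 < r / w := by positivity
  let K : ℤ := ⌊R / (r / w)⌋ + 1
  let G : Finset (Fin d → ℤ) := Fintype.piFinset fun _ => Finset.Icc (-K) K
  have hcell : ∀ x ∈ B, cell x ∈ G := fun x hx => by
    rw [Fintype.mem_piFinset]
    intro i
    have h1 : |x i| ≤ R := by
      have := PiLp.norm_apply_le x i
      rw [Real.norm_eq_abs] at this
      exact this.trans (hR x hx)
    rw [abs_le] at h1
    have h2 : x i / (r / w) ≤ R / (r / w) := by gcongr; exact h1.2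
    have h3 : -(R / (r / w)) ≤ x i / (r / w) := by
      rw [← neg_div]; gcongr; exact h1.1
    rw [Finset.mem_Icc]
    constructor
    · rw [Int.le_floor]
      have := Int.lt_floor_add_one (R / (r / w))
      simp only [K]; push_cast; linarith
    · have := Int.floor_le_floor h2
      simp only [cell, K]; linarith
  -- One point of `B` is chosen in each occupied cube, so that the net lies in `B` itself, where the
  -- moment bounds hold.
  let pick : (Fin d → ℤ) → EuclideanSpace ℝ (Fin d) := fun c =>
    if h : ∃ x ∈ B, cell x = c then h.choose else 0
  let G' := G.filter fun c => ∃ x ∈ B, cell x = c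
  refine ⟨G'.image pick, ?_, ?_, ?_⟩
  · intro y hy
    simp only [Finset.coe_image, Set.mem_image, Finset.mem_coe, G', Finset.mem_filter] at hy
    obtain ⟨c, ⟨-, hc⟩, rfl⟩ := hy
    simp only [pick, dif_pos hc]
    exact hc.choose_spec.1
  · have hK0 : 0 ≤ K := by
      have : 0 ≤ ⌊R / (r / w)⌋ := Int.floor_nonneg.2 (by positivity)
      simp only [K]; linarith
    have hcard : (G'.image pick).card ≤ (2 * K + 1).toNat ^ d := by
      refine Finset.card_image_le.trans ((Finset.card_filter_le _ _).trans ?_)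
      simp only [G, Fintype.card_piFinset, Int.card_Icc, Finset.prod_const, Finset.card_univ,
        Fintype.card_fin]
      refine Nat.pow_le_pow_left (by omega) d
    have hcast : ((2 * K + 1).toNat : ℝ) = 2 * (K : ℝ) + 1 := by
      have : (((2 * K + 1).toNat : ℤ) : ℝ) = ((2 * K + 1 : ℤ) : ℝ) := by
        rw [Int.toNat_of_nonneg (by omega)]
      push_cast at this
      exact this
    have hKle : 2 * (K : ℝ) + 1 ≤ (2 * R * w + 3) / r := by
      have h1 : (⌊R / (r / w)⌋ : ℝ) ≤ R / (r / w) := Int.floor_le _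
      have h2 : R / (r / w) = R * w / r := by field_simp
      have h3 : 3 ≤ 3 / r := by rw [le_div_iff₀ hr]; linarith
      simp only [K]; push_cast
      rw [h2] at h1
      have : (2 * R * w + 3) / r = 2 * (R * w / r) + 3 / r := by ring
      linarith
    calc ((G'.image pick).card : ℝ) ≤ (((2 * K + 1).toNat ^ d : ℕ) : ℝ) := by exact_mod_cast hcard
      _ = (2 * (K : ℝ) + 1) ^ d := by push_cast; rw [hcast]
      _ ≤ ((2 * R * w + 3) / r) ^ d := by
          have : (0 : ℝ) ≤ K := by exact_mod_cast hK0
          gcongr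
      _ = _ := by rw [div_pow, Real.rpow_neg hr.le, Real.rpow_natCast]; rfl
  · intro x hx
    have hex : ∃ y ∈ B, cell y = cell x := ⟨x, hx, rfl⟩
    refine ⟨pick (cell x), Finset.mem_image_of_mem _ (by simp [G', hcell x hx, hex]), ?_⟩
    have hp : cell (pick (cell x)) = cell x := by
      simp only [pick, dif_pos hex]; exact hex.choose_spec.2
    rw [EuclideanSpace.dist_eq]
    have h1 : ∀ i, dist (x i) (pick (cell x) i) ^ 2 ≤ (r / w) ^ 2 := fun i => by
      have h2 := Int.abs_sub_lt_one_of_floor_eq_floor (congrFun hp i)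
      rw [← sub_div, abs_div, abs_of_pos hh, div_lt_one hh] at h2
      rw [Real.dist_eq, abs_sub_comm]
      gcongr
    calc Real.sqrt (∑ i, dist (x i) (pick (cell x) i) ^ 2)
        ≤ Real.sqrt (∑ _i : Fin d, (r / w) ^ 2) :=
          Real.sqrt_le_sqrt (Finset.sum_le_sum fun i _ => h1 i)
      _ = Real.sqrt d * (r / w) := by
          rw [Finset.sum_const, Finset.card_univ, Fintype.card_fin, nsmul_eq_mul,
            Real.sqrt_mul (by positivity), Real.sqrt_sq hh.le]
      _ ≤ w * (r / w) := by gcongr; linarith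
      _ = r := by field_simp

end Net

/-! ### Absorbing the net and the mixing gap into the summability condition. -/

section Slack

/-- The number of consecutive blocks of length `n` after which mixing of rate `exp (-γ m^θ)` beats
`exp (-4 L) n⁻²`. -/
noncomputable def mixingGap (γ θ L : ℝ) (n : ℕ) : ℕ :=
  ⌈3 * ((4 * L + 2 * Real.log n) / γ) ^ (1 / θ) / n⌉₊ + 3

/-- Growth facts consumed by `exponent_le_or_le`, where `L = log k(n)` and the mixing gap is at most
`L^A`. -/
theorem eventually_log_bounds (A C : ℝ) : ∀ᶠ L : ℝ in atTop, 1 ≤ L ∧ 1 ≤ Real.log L ∧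
    C ≤ Real.log L ∧ 4 * A * Real.log L ≤ L ∧ 4 * Real.log L ≤ Real.sqrt L ∧
    4 * A * Real.log L ^ 2 ≤ L := by
  have h1 : ∀ᶠ L : ℝ in atTop, 4 * |A| * Real.log L ^ 2 ≤ L := by
    have h := (Real.isLittleO_pow_log_id_atTop (n := 2)).bound
      (show (0 : ℝ) < 1 / (4 * |A| + 1) by positivity)
    filter_upwards [h, eventually_ge_atTop 0] with L hL hL0
    simp only [id, Real.norm_eq_abs] at hL
    rw [abs_of_nonneg (sq_nonneg _), abs_of_nonneg hL0, one_div, ← div_eq_inv_mul,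
      le_div_iff₀ (by positivity)] at hL
    nlinarith [sq_nonneg (Real.log L)]
  have h2 : ∀ᶠ L : ℝ in atTop, 4 * Real.log L ≤ Real.sqrt L := by
    have h := (isLittleO_log_rpow_atTop (show (0 : ℝ) < 1 / 2 by norm_num)).bound
      (show (0 : ℝ) < 1 / 4 by norm_num)
    filter_upwards [h, eventually_ge_atTop 0] with L hL hL0
    rw [Real.norm_eq_abs, Real.norm_eq_abs, ← Real.sqrt_eq_rpow,
      abs_of_nonneg (Real.sqrt_nonneg _)] at hL
    linarith [le_abs_self (Real.log L)]
  filter_upwards [h1, h2, eventually_ge_atTop 1, Real.tendsto_log_atTop.eventually_ge_atTop 1,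
    Real.tendsto_log_atTop.eventually_ge_atTop C] with L hL1 hL2 hL3 hL4 hL5
  have h3 : 4 * A * Real.log L ≤ 4 * |A| * Real.log L ^ 2 := by
    have : A * Real.log L ≤ |A| * Real.log L ^ 2 := by
      calc A * Real.log L ≤ |A| * Real.log L := by gcongr; exact le_abs_self A
        _ ≤ |A| * Real.log L ^ 2 := by gcongr; nlinarith
    linarith
  have h4 : 4 * A * Real.log L ^ 2 ≤ 4 * |A| * Real.log L ^ 2 := by
    gcongr; exact le_abs_self A
  exact ⟨hL3, hL4, hL5, h3.trans hL1, hL2, h4.trans hL1⟩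

/-- The loss of a factor `q^u`, with `q` polynomial in `L`, is absorbed by the slack between the
exponents, unless the whole term is tiny. -/
theorem exponent_le_or_le {D A a x δ u l n L w : ℝ} (hD : 0 ≤ D) (hA : 0 ≤ A) (ha : 0 ≤ a)
    (hax : a ≤ x) (hδ : 0 ≤ δ) (hu : 0 < u) (hu1 : u ≤ 1 / 8) (hl : 0 ≤ l) (hn : 0 ≤ n)
    (hL : 1 ≤ L ∧ 1 ≤ Real.log L ∧ 8 * (D + 3 / 2) + 8 ≤ Real.log L ∧ 4 * A * Real.log L ≤ L ∧
      4 * Real.log L ≤ Real.sqrt L ∧ 4 * A * Real.log L ^ 2 ≤ L)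
    (hw : w ≤ A * Real.log L) :
    u * w - u * L + (D + 5 / 4 + u) * l + n * (u * a + u ^ 2 * x + 5 / 2 * δ) ≤
        A + (-u * (L - n * a) + (D + 3 / 2) * l + 3 * n * (x * u ^ 2 + δ)) ∨
      u * w - u * L + (D + 5 / 4 + u) * l + n * (u * a + u ^ 2 * x + 5 / 2 * δ) ≤
        -Real.sqrt L := by
  obtain ⟨hL1, hg1, hgC, hAg, hgs, hAg2⟩ := hL
  set g := Real.log L with hg
  have hx : 0 ≤ x := ha.trans hax
  have hul : u * l ≤ 1 / 8 * l := by gcongr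
  have hnx : 0 ≤ n * (u ^ 2 * x) := by positivity
  have hnd : 0 ≤ n * δ := by positivity
  have huw : u * w ≤ u * (A * g) := by gcongr
  -- Here `u = √ε`, `l = -log ε`, `w = log q`. If `u log L ≤ 1`, then `q^u ≤ exp A` is a constant.
  by_cases h1 : u * g ≤ 1
  · left
    have : u * (A * g) ≤ A := by nlinarith
    nlinarith
  push Not at h1
  -- A lower bound for the slack between the two exponents: `1/4 - u ≥ 1/8` in the power of `ε`, `3
  -- - 1` in front of `x`, `3 - 5/2` in front of `δ`. The terms in `a` cancel exactly.
  set s := l / 8 + 2 * (n * (u ^ 2 * x)) + n * δ / 2 with hs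
  -- If the positive terms use at most half of `u L`, the exponent is at most `-u L / 4`, and `u √L
  -- ≥ 4` makes this at most `-√L`. Otherwise `u L` is at most `4 s log L`, and `u w ≤ s` follows.
  by_cases h2 : n * (u * a) + (D + 3 / 2) * l + 3 * (n * (u ^ 2 * x)) + 3 * (n * δ) ≤ u * L / 2
  · right
    have h3 : u * (A * g) ≤ u * (L / 4) := by gcongr; linarith
    have hsq : Real.sqrt L * Real.sqrt L = L := Real.mul_self_sqrt (by linarith)
    have hsq0 : 0 < Real.sqrt L := Real.sqrt_pos.2 (by linarith)
    have h4 : 4 ≤ u * Real.sqrt L := by nlinarith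
    have h5 : 4 * Real.sqrt L ≤ u * L := by
      calc 4 * Real.sqrt L ≤ u * Real.sqrt L * Real.sqrt L := by gcongr
        _ = u * L := by rw [mul_assoc, hsq]
    nlinarith
  · left
    push Not at h2
    -- The `a` term has no slack of its own; `a ≤ x` and `1 < u log L` charge it to the `x` term at
    -- the cost of a factor `log L`.
    have h3 : n * (u * a) ≤ n * (u ^ 2 * x) * g := by
      have : u * a ≤ u ^ 2 * x * g := by
        calc u * a ≤ u * x := by gcongr
          _ ≤ (u * g) * (u * x) := le_mul_of_one_le_left (by positivity) h1.le
          _ = _ := by ring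
      calc n * (u * a) ≤ n * (u ^ 2 * x * g) := by gcongr
        _ = _ := by ring
    have hs0 : 0 ≤ s := by positivity
    have h4 : u * L / 2 ≤ s * (2 * g) := by
      have e1 : n * (u ^ 2 * x) * g ≤ s * g := by gcongr; rw [hs]; linarith [hnx, hnd, hl]
      have e2 : (D + 3 / 2) * l ≤ (D + 3 / 2) * (8 * s) := by
        gcongr; rw [hs]; linarith [hnx, hnd, hl]
      have e3 : 3 * (n * (u ^ 2 * x)) + 3 * (n * δ) ≤ 8 * s := by
        rw [hs]; linarith [hnx, hnd, hl]
      have e4 : s * (8 * (D + 3 / 2) + 8) ≤ s * g := by gcongr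
      nlinarith
    have h5 : u * (A * g) ≤ s := by
      have e1 : u * (4 * A * g ^ 2) ≤ u * L := by gcongr
      have e2 : u * (A * g) * (4 * g) ≤ s * (4 * g) := by nlinarith
      exact le_of_mul_le_mul_right e2 (by linarith)
    nlinarith

/-- If `L ≤ n^{θ/2}`, the required separation is at most a constant number of blocks of length `n`.
If not, `log n ≤ L`, so the gap is polynomial in `L`; moreover `exp(-√L)` is then at most
`exp(-n^{θ/4})`, which is summable. -/
theorem eventually_log_mixingGap_le {γ θ : ℝ} (hγ : 0 < γ) (hθ : 0 < θ) :
    ∀ᶠ n : ℕ in atTop, ∀ L : ℝ, 0 ≤ L → Real.log (mixingGap γ θ L n) ≤ 2 ∨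
      ((n : ℝ) ^ (θ / 2) ≤ L ∧ Real.log (mixingGap γ θ L n) ≤ (1 / θ + 1) * Real.log L) := by
  set c := 3 * (6 / γ) ^ (1 / θ) with hc
  have hc0 : 0 < c := by positivity
  have hpow : Tendsto (fun n : ℕ => (n : ℝ) ^ (θ / 2)) atTop atTop :=
    (tendsto_rpow_atTop (by positivity)).comp tendsto_natCast_atTop_atTop
  have hlog : ∀ᶠ n : ℕ in atTop, Real.log n ≤ (n : ℝ) ^ (θ / 2) := by
    have h := (isLittleO_log_rpow_atTop (show 0 < θ / 2 by positivity)).bound one_pos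
    filter_upwards [tendsto_natCast_atTop_atTop.eventually h] with n hn
    rw [Real.norm_eq_abs, Real.norm_eq_abs,
      abs_of_nonneg (by positivity : (0 : ℝ) ≤ (n : ℝ) ^ (θ / 2)), one_mul] at hn
    exact (le_abs_self _).trans hn
  filter_upwards [hlog, hpow.eventually_ge_atTop (6 / γ), hpow.eventually_ge_atTop (4 + c),
    eventually_ge_atTop 1] with n hln hn1 hn2 hn3 L hL
  have hn0 : (1 : ℝ) ≤ n := by exact_mod_cast hn3
  have hlogn : 0 ≤ Real.log n := Real.log_nonneg hn0
  set b := 3 * ((4 * L + 2 * Real.log n) / γ) ^ (1 / θ) / n with hb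
  have hb0 : 0 ≤ b := by positivity
  have hq : (mixingGap γ θ L n : ℝ) ≤ b + 4 := by
    have := (Nat.ceil_lt_add_one hb0).le
    simp only [mixingGap]; push_cast; linarith
  have hq0 : (0 : ℝ) < mixingGap γ θ L n := by
    simp only [mixingGap]; positivity
  by_cases h : L ≤ (n : ℝ) ^ (θ / 2)
  · left
    have h1 : (4 * L + 2 * Real.log n) / γ ≤ (n : ℝ) ^ θ := by
      have e : (n : ℝ) ^ θ = (n : ℝ) ^ (θ / 2) * (n : ℝ) ^ (θ / 2) := by
        rw [← Real.rpow_add (by linarith)]; ring_nf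
      rw [e, div_le_iff₀ hγ]
      rw [div_le_iff₀ hγ] at hn1
      have : (0 : ℝ) ≤ (n : ℝ) ^ (θ / 2) := by positivity
      nlinarith
    have h2 : ((4 * L + 2 * Real.log n) / γ) ^ (1 / θ) ≤ n := by
      calc _ ≤ ((n : ℝ) ^ θ) ^ (1 / θ) := by gcongr
        _ = n := by rw [← Real.rpow_mul (by linarith), mul_one_div_cancel hθ.ne', Real.rpow_one]
    have h3 : b ≤ 3 := by
      rw [hb, div_le_iff₀ (by linarith)]; linarith
    -- The gap is at most `3 + 4 = 7`, and `7 < e²`.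
    rw [Real.log_le_iff_le_exp hq0]
    have h4 : Real.exp 2 = Real.exp 1 * Real.exp 1 := by rw [← Real.exp_add]; norm_num
    have := Real.exp_one_gt_d9
    nlinarith
  · right
    push Not at h
    refine ⟨h.le, ?_⟩
    have hL4 : 4 + c ≤ L := hn2.trans h.le
    have hL1 : 1 ≤ L := by linarith
    have h1 : b ≤ c * L ^ (1 / θ) := by
      calc b ≤ 3 * ((4 * L + 2 * Real.log n) / γ) ^ (1 / θ) := by
            rw [hb]; exact div_le_self (by positivity) hn0
        _ ≤ 3 * (6 / γ * L) ^ (1 / θ) := by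
            gcongr
            rw [div_mul_eq_mul_div]
            gcongr
            linarith
        _ = c * L ^ (1 / θ) := by
            rw [Real.mul_rpow (by positivity) (by positivity), hc]; ring
    have h2 : (1 : ℝ) ≤ L ^ (1 / θ) := Real.one_le_rpow hL1 (by positivity)
    have h3 : (mixingGap γ θ L n : ℝ) ≤ L ^ (1 / θ + 1) := by
      rw [Real.rpow_add (by linarith), Real.rpow_one]
      nlinarith
    calc Real.log (mixingGap γ θ L n) ≤ Real.log (L ^ (1 / θ + 1)) := Real.log_le_log hq0 h3
      _ = _ := Real.log_rpow (by linarith) _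

/-- Makes the mixing term at most `k⁻⁴ n⁻²`: half of the `k⁻⁴` cancels the factor `k²` of the weak
law, the rest pays for the net, and `n⁻²` is summable. -/
theorem four_mul_add_le_mixingGap {γ θ L : ℝ} (hγ : 0 < γ) (hθ : 0 < θ) (hL : 0 ≤ L) {n : ℕ}
    (hn : 1 ≤ n) :
    4 * L + 2 * Real.log n ≤ γ * (((mixingGap γ θ L n - 2) * n + 1 : ℕ) : ℝ) ^ θ := by
  have hn0 : (1 : ℝ) ≤ n := by exact_mod_cast hn
  have hlogn : 0 ≤ Real.log n := Real.log_nonneg hn0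
  set b := 3 * ((4 * L + 2 * Real.log n) / γ) ^ (1 / θ) / n with hb
  have hb0 : 0 ≤ b := by positivity
  have h1 : ((4 * L + 2 * Real.log n) / γ) ^ (1 / θ) ≤
      (((mixingGap γ θ L n - 2) * n + 1 : ℕ) : ℝ) := by
    have h2 : mixingGap γ θ L n - 2 = ⌈b⌉₊ + 1 := by simp only [mixingGap, ← hb]; omega
    rw [h2]
    push_cast
    have h3 : b ≤ ⌈b⌉₊ := Nat.le_ceil b
    have h4 : b * n = 3 * ((4 * L + 2 * Real.log n) / γ) ^ (1 / θ) := by rw [hb]; field_simp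
    have h5 : 0 ≤ ((4 * L + 2 * Real.log n) / γ) ^ (1 / θ) := by positivity
    nlinarith
  have h2 : (4 * L + 2 * Real.log n) / γ ≤ (((mixingGap γ θ L n - 2) * n + 1 : ℕ) : ℝ) ^ θ := by
    calc (4 * L + 2 * Real.log n) / γ = (((4 * L + 2 * Real.log n) / γ) ^ (1 / θ)) ^ θ := by
          rw [← Real.rpow_mul (by positivity), one_div_mul_cancel hθ.ne', Real.rpow_one]
      _ ≤ _ := by gcongr
  rw [div_le_iff₀ hγ] at h2
  linarith

theorem summable_exp_neg_rpow {c : ℝ} (hc : 0 < c) :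
    Summable fun n : ℕ => Real.exp (-(n : ℝ) ^ c) := by
  refine summable_of_isBigO_nat (Real.summable_nat_rpow_inv.2 (show (1 : ℝ) < 2 by norm_num)) ?_
  have h := (isLittleO_log_rpow_atTop hc).bound (show (0 : ℝ) < 1 / 2 by norm_num)
  refine Asymptotics.IsBigO.of_bound 1 ?_
  filter_upwards [tendsto_natCast_atTop_atTop.eventually h, eventually_ge_atTop 1] with n hn hn1
  have hn0 : (1 : ℝ) ≤ n := by exact_mod_cast hn1
  rw [Real.norm_eq_abs, Real.norm_eq_abs, abs_of_nonneg (by positivity : (0 : ℝ) ≤ (n : ℝ) ^ c),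
    abs_of_nonneg (Real.log_nonneg hn0)] at hn
  rw [Real.norm_eq_abs, Real.abs_exp, one_mul, Real.norm_eq_abs,
    abs_of_nonneg (by positivity : (0 : ℝ) ≤ ((n : ℝ) ^ (2 : ℝ))⁻¹),
    ← Real.rpow_neg (Nat.cast_nonneg n),
    Real.rpow_def_of_pos (show (0 : ℝ) < n by linarith) (-2)]
  exact Real.exp_le_exp.2 (by linarith)

/-- The summability condition absorbs the covering number and the mixing gap. -/
theorem summable_of_bc (d : ℕ) {γ θ a x : ℝ} (hγ : 0 < γ) (hθ : 0 < θ) (ha : 0 ≤ a) (hax : a ≤ x)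
    {k : ℕ → ℕ} {ε δ : ℕ → ℝ} (hk : ∀ n, 1 ≤ n → 0 < k n) (hεpos : ∀ n, 1 ≤ n → 0 < ε n)
    (hε : Tendsto ε atTop (𝓝 0)) (hδ : ∀ n, 1 ≤ n → 0 ≤ δ n)
    (hsum : Summable fun n : ℕ => Real.exp (-Real.sqrt (ε n) * (Real.log (k n) - n * a)) *
      ε n ^ (-((d : ℝ) + 3 / 2)) * Real.exp (3 * n * (x * ε n + δ n))) :
    (Summable fun n : ℕ => ε n ^ (-((d : ℝ) + 1 / 4)) *
      (((mixingGap γ θ (Real.log (k n)) n : ℝ) / k n) ^ Real.sqrt (ε n) *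
        ε n ^ (-(1 + Real.sqrt (ε n))) *
        Real.exp (n * (Real.sqrt (ε n) * a + ε n * x + 5 / 2 * δ n)))) ∧
    Summable fun n : ℕ => ε n ^ (-((d : ℝ) + 1 / 4)) * (Real.exp (-γ *
      (((mixingGap γ θ (Real.log (k n)) n - 2) * n + 1 : ℕ) : ℝ) ^ θ) * (k n : ℝ) ^ 2) := by
  have hsmall : ∀ᶠ n in atTop, ε n ≤ 1 / 64 :=
    (hε.eventually_lt_const (show (0 : ℝ) < 1 / 64 by norm_num)).mono fun n h => h.le
  have hterm : ∀ n, 1 ≤ n → Real.exp (-Real.sqrt (ε n) * (Real.log (k n) - n * a)) *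
      ε n ^ (-((d : ℝ) + 3 / 2)) * Real.exp (3 * n * (x * ε n + δ n)) =
      Real.exp (-Real.sqrt (ε n) * (Real.log (k n) - n * a) + ((d : ℝ) + 3 / 2) * -Real.log (ε n) +
        3 * n * (x * ε n + δ n)) := fun n hn => by
    rw [Real.rpow_def_of_pos (hεpos n hn), ← Real.exp_add, ← Real.exp_add]
    congr 1; ring
  constructor
  · have hpow : Tendsto (fun n : ℕ => (n : ℝ) ^ (θ / 2)) atTop atTop :=
      (tendsto_rpow_atTop (by positivity)).comp tendsto_natCast_atTop_atTop
    obtain ⟨L₀, hL₀⟩ := eventually_atTop.1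
      (eventually_log_bounds (1 / θ + 1) (8 * ((d : ℝ) + 3 / 2) + 8))
    set K := Real.exp (2 + (1 / θ + 1)) with hK
    refine Summable.of_norm_bounded_eventually_nat
      ((hsum.mul_left K).add (summable_exp_neg_rpow (show 0 < θ / 4 by positivity))) ?_
    filter_upwards [hsmall, eventually_log_mixingGap_le hγ hθ, eventually_ge_atTop 1,
      hpow.eventually_ge_atTop L₀] with n hn1 hgap hn hnL
    have hε0 := hεpos n hn
    have hk0 : (0 : ℝ) < k n := by exact_mod_cast hk n hn
    have hLk : 0 ≤ Real.log (k n) := Real.log_nonneg (by exact_mod_cast hk n hn)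
    have hq0 : (0 : ℝ) < mixingGap γ θ (Real.log (k n)) n := by
      simp only [mixingGap]; positivity
    set u := Real.sqrt (ε n) with hu
    have hu0 : 0 < u := Real.sqrt_pos.2 hε0
    have hu2 : u ^ 2 = ε n := Real.sq_sqrt hε0.le
    have hu1 : u ≤ 1 / 8 := by
      rw [hu, Real.sqrt_le_left (by norm_num)]; linarith
    have hl : 0 ≤ -Real.log (ε n) := by
      have := Real.log_nonpos hε0.le (by linarith); linarith
    rw [hterm n hn]
    set L := Real.log (k n) with hLdef
    set w := Real.log (mixingGap γ θ L n) with hw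
    set l := -Real.log (ε n) with hldef
    have hn0 : (0 : ℝ) ≤ n := by positivity
    have eqn : ε n ^ (-((d : ℝ) + 1 / 4)) * (((mixingGap γ θ L n : ℝ) / k n) ^ u *
        ε n ^ (-(1 + u)) * Real.exp (n * (u * a + ε n * x + 5 / 2 * δ n))) =
        Real.exp (u * w - u * L + ((d : ℝ) + 5 / 4 + u) * l +
          n * (u * a + u ^ 2 * x + 5 / 2 * δ n)) := by
      rw [Real.rpow_def_of_pos hε0, Real.rpow_def_of_pos hε0,
        Real.rpow_def_of_pos (div_pos hq0 hk0), Real.log_div hq0.ne' hk0.ne', ← Real.exp_add,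
        ← Real.exp_add, ← Real.exp_add, hu2]
      congr 1
      simp only [← hw, ← hLdef, hldef]
      ring
    rw [eqn, Real.norm_eq_abs, Real.abs_exp]
    have hcase : u * w - u * L + ((d : ℝ) + 5 / 4 + u) * l +
          n * (u * a + u ^ 2 * x + 5 / 2 * δ n) ≤ (2 + (1 / θ + 1)) +
          (-u * (L - n * a) + ((d : ℝ) + 3 / 2) * l + 3 * n * (x * ε n + δ n)) ∨
        u * w - u * L + ((d : ℝ) + 5 / 4 + u) * l +
          n * (u * a + u ^ 2 * x + 5 / 2 * δ n) ≤ -(n : ℝ) ^ (θ / 4) := by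
      have hθ' : 0 < 1 / θ := by positivity
      rcases hgap L hLk with h | ⟨h1, h2⟩
      · left
        have e1 : u * w ≤ u * 2 := by gcongr
        have e2 : u * l ≤ 1 / 8 * l := by gcongr
        have e3 : 0 ≤ n * δ n := mul_nonneg hn0 (hδ n hn)
        have e4 : 0 ≤ n * (ε n * x) := mul_nonneg hn0 (mul_nonneg hε0.le (ha.trans hax))
        rw [hu2]
        nlinarith
      · rcases exponent_le_or_le (D := d) (A := 1 / θ + 1) (by positivity) (by positivity) ha hax
          (hδ n hn) hu0 hu1 hl hn0 (hL₀ L (hnL.trans h1)) h2 with h | h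
        · left
          rw [hu2] at h ⊢
          linarith
        · right
          refine h.trans (neg_le_neg ?_)
          rw [Real.sqrt_eq_rpow]
          calc (n : ℝ) ^ (θ / 4) = ((n : ℝ) ^ (θ / 2)) ^ (1 / 2 : ℝ) := by
                rw [← Real.rpow_mul hn0]; congr 1; ring
            _ ≤ _ := by gcongr
    rcases hcase with h | h
    · refine (Real.exp_le_exp.2 h).trans ?_
      rw [Real.exp_add]
      exact le_add_of_nonneg_right (Real.exp_pos _).le
    · exact (Real.exp_le_exp.2 h).trans (le_add_of_nonneg_left (by positivity))
  · refine Summable.of_norm_bounded_eventually_nat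
      (Real.summable_nat_rpow_inv.2 (show (1 : ℝ) < 2 by norm_num)) ?_
    -- Terms of a convergent series are eventually below `1`; taking logarithms, `ε^{-(d+3/2)} ≤
    -- k(n)`, so the size of the net is at most a power of `k(n)`.
    have hle1 := hsum.tendsto_atTop_zero.eventually_lt_const (show (0 : ℝ) < 1 by norm_num)
    filter_upwards [hsmall, hle1, eventually_ge_atTop 1] with n hn1 hn2 hn
    have hε0 := hεpos n hn
    have hn0 : (1 : ℝ) ≤ n := by exact_mod_cast hn
    have hk0 : (0 : ℝ) < k n := by exact_mod_cast hk n hn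
    have hLk : 0 ≤ Real.log (k n) := Real.log_nonneg (by exact_mod_cast hk n hn)
    rw [hterm n hn, Real.exp_lt_one_iff] at hn2
    have hl : 0 ≤ -Real.log (ε n) := by
      have := Real.log_nonpos hε0.le (by linarith); linarith
    set u := Real.sqrt (ε n) with hu
    have hu0 : 0 < u := Real.sqrt_pos.2 hε0
    have hu1 : u ≤ 1 / 8 := by
      rw [hu, Real.sqrt_le_left (by norm_num)]; linarith
    have hgap := four_mul_add_le_mixingGap hγ hθ hLk hn
    set m := (((mixingGap γ θ (Real.log (k n)) n - 2) * n + 1 : ℕ) : ℝ) with hm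
    set L := Real.log (k n) with hLdef
    have e1 : ((d : ℝ) + 3 / 2) * -Real.log (ε n) ≤ L := by
      have e2 : 0 ≤ 3 * n * (x * ε n + δ n) := by
        have := hδ n hn; have := ha.trans hax; positivity
      have e3 : 0 ≤ u * (n * a) := by positivity
      have e4 : u * L ≤ 1 / 8 * L := by gcongr
      nlinarith
    have eqn : ε n ^ (-((d : ℝ) + 1 / 4)) * (Real.exp (-γ * m ^ θ) * (k n : ℝ) ^ 2) =
        Real.exp (((d : ℝ) + 1 / 4) * -Real.log (ε n) - γ * m ^ θ + 2 * L) := by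
      have hkL : (k n : ℝ) ^ 2 = Real.exp (2 * L) := by
        rw [hLdef, two_mul, Real.exp_add, Real.exp_log hk0, sq]
      rw [Real.rpow_def_of_pos hε0, hkL, ← Real.exp_add, ← Real.exp_add]
      congr 1; ring
    rw [eqn, Real.norm_eq_abs, Real.abs_exp, ← Real.rpow_neg (by linarith),
      Real.rpow_def_of_pos (show (0 : ℝ) < n by linarith)]
    gcongr
    nlinarith

end Slack

/-! ### Blocks of a stationary mixing process. -/

section Blocks

variable {Ω : Type*} [mΩ : MeasurableSpace Ω] {E : Type*} [mE : MeasurableSpace E]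

theorem measurable_path {X : ℕ → Ω → E} (hX : ∀ i, Measurable (X i)) : Measurable (path X) :=
  measurable_pi_lambda _ hX

theorem measurable_shift (s : ℕ) : Measurable (shift (E := E) s) :=
  measurable_pi_lambda _ fun i => measurable_pi_apply (i + s)

theorem map_path_add {P : Measure Ω} {X : ℕ → Ω → E} (hX : ∀ i, Measurable (X i))
    (hstat : Stationary P X) (s : ℕ) : P.map (fun ω => shift s (path X ω)) = P.map (path X) := by
  induction s with
  | zero => rfl
  | succ s ih =>
    have h1 : (fun ω => shift (s + 1) (path X ω)) = shift 1 ∘ fun ω => shift s (path X ω) := by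
      funext ω i
      simp only [shift, path, Function.comp]
      congr 1; ring
    have h2 : Measurable fun ω => shift s (path X ω) :=
      (measurable_shift s).comp (measurable_path hX)
    rw [h1, ← Measure.map_map (measurable_shift 1) h2, ih,
      Measure.map_map (measurable_shift 1) (measurable_path hX)]
    exact hstat

/-- A function of `N` coordinates, evaluated along the path shifted by `s`, is measurable with
respect to the variables with indices in `[s, s + N)`. -/
theorem measurable_comp_shift_path {F : Type*} [MeasurableSpace F] {f : (ℕ → E) → F}
    (hf : Measurable f) {N : ℕ} (hdep : DependsOn f (Set.Iio N)) {X : ℕ → Ω → E} {s : ℕ}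
    {m : MeasurableSpace Ω} (hm : ∀ i, s ≤ i → i < s + N → mE.comap (X i) ≤ m) :
    Measurable[m] fun ω => f (shift s (path X ω)) := by
  rcases isEmpty_or_nonempty Ω with hΩ | ⟨⟨ω₀⟩⟩
  · intro t _
    rw [Set.eq_empty_of_isEmpty ((fun ω => f (shift s (path X ω))) ⁻¹' t)]
    exact @MeasurableSet.empty _ m
  -- The irrelevant coordinates are frozen at the constant `X 0 ω₀`, so that only the variables of
  -- the block remain.
  let g : Ω → ℕ → E := fun ω i => if i < N then X (i + s) ω else X 0 ω₀
  have hg : Measurable[m] g := by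
    refine @measurable_pi_lambda _ _ _ m _ g fun i => ?_
    by_cases hi : i < N
    · simp only [g, hi, if_true]
      exact (comap_measurable (X (i + s))).mono (hm _ (by omega) (by omega)) le_rfl
    · simp only [g, hi, if_false]
      exact measurable_const
  have hfg : (fun ω => f (shift s (path X ω))) = f ∘ g := by
    funext ω
    refine hdep fun i hi => ?_
    simp only [Set.mem_Iio] at hi
    simp [g, hi, shift, path]
  rw [hfg]
  exact hf.comp hg

variable {P : Measure Ω} [IsProbabilityMeasure P]

theorem abs_measureReal_mul_sub_le_one (U V : Set Ω) :
    |P.real U * P.real V - P.real (U ∩ V)| ≤ 1 := by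
  have h1 : P.real U * P.real V ≤ 1 :=
    mul_le_one₀ measureReal_le_one measureReal_nonneg measureReal_le_one
  have h2 : 0 ≤ P.real U * P.real V := mul_nonneg measureReal_nonneg measureReal_nonneg
  have h3 : P.real (U ∩ V) ≤ 1 := measureReal_le_one
  have h4 : 0 ≤ P.real (U ∩ V) := measureReal_nonneg
  rw [abs_le]; constructor <;> linarith

/-- The supremum of an unbounded set of reals is `0` by convention, so a bound is needed before the
coefficients dominate their members; the crude bound `1` is enough. -/
theorem alphaCoeff_le_one (𝓤 𝓥 : MeasurableSpace Ω) : @alphaCoeff Ω mΩ P 𝓤 𝓥 ≤ 1 :=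
  Real.sSup_le (fun _ ⟨U, V, _, _, h⟩ => h ▸ @abs_measureReal_mul_sub_le_one _ mΩ P _ U V)
    zero_le_one

theorem le_alphaMix (X : ℕ → Ω → E) {m : ℕ} (hm : m ≠ 0) (i : ℕ) {U V : Set Ω}
    (hU : MeasurableSet[⨆ k : {k : ℕ // k ≤ i}, mE.comap (X k)] U)
    (hV : MeasurableSet[⨆ j : {j : ℕ // i + m ≤ j}, mE.comap (X j)] V) :
    |P.real U * P.real V - P.real (U ∩ V)| ≤ alphaMix P X m := by
  rw [alphaMix, if_neg hm]
  refine le_trans ?_ (le_ciSup (f := fun i : ℕ =>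
    alphaCoeff P (⨆ k : {k : ℕ // k ≤ i}, mE.comap (X k))
      (⨆ j : {j : ℕ // i + m ≤ j}, mE.comap (X j)))
    ⟨1, by rintro _ ⟨i, rfl⟩; exact alphaCoeff_le_one (mΩ := mΩ) _ _⟩ i)
  refine le_csSup ⟨1, ?_⟩ ⟨U, V, hU, hV, rfl⟩
  rintro r ⟨U, V, -, -, rfl⟩
  exact abs_measureReal_mul_sub_le_one U V

/-- Functions of blocks of length `2n` started at `in` and `jn` are nearly independent. -/
theorem abs_measureReal_block_le {f : (ℕ → E) → ℝ} (hf : Measurable f) {n : ℕ}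
    (hdep : DependsOn f (Set.Iio (2 * n))) (X : ℕ → Ω → E) {q i j : ℕ} (hq : 2 ≤ q)
    (hij : i + q ≤ j) {A B : Set ℝ} (hA : MeasurableSet A) (hB : MeasurableSet B) :
    |P.real ((fun ω => f (shift (i * n) (path X ω))) ⁻¹' A) *
        P.real ((fun ω => f (shift (j * n) (path X ω))) ⁻¹' B) -
      P.real ((fun ω => f (shift (i * n) (path X ω))) ⁻¹' A ∩
        (fun ω => f (shift (j * n) (path X ω))) ⁻¹' B)| ≤ alphaMix P X ((q - 2) * n + 1) := by
  obtain ⟨r, rfl⟩ := Nat.exists_eq_add_of_le hq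
  have hjn : i * n + 2 * n + r * n ≤ j * n := by
    have := Nat.mul_le_mul_right n hij
    nlinarith
  -- For `n ≥ 1` the first block ends at index `i n + 2 n - 1` and the second starts no earlier than
  -- `(i + q) n`, which is `(q - 2) n + 1` later.
  refine le_alphaMix X (by omega) (i * n + 2 * n - 1) ?_ ?_
  · refine measurable_comp_shift_path hf hdep (fun l h1 h2 => ?_) hA
    exact le_iSup (fun k : {k : ℕ // k ≤ i * n + 2 * n - 1} => mE.comap (X k)) ⟨l, by omega⟩
  · refine measurable_comp_shift_path hf hdep (fun l h1 h2 => ?_) hB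
    refine le_iSup (fun k : {k : ℕ // i * n + 2 * n - 1 + ((2 + r - 2) * n + 1) ≤ k} =>
      mE.comap (X k)) ⟨l, ?_⟩
    rw [Nat.add_sub_cancel_left]
    omega

theorem identDistrib_block {f : (ℕ → E) → ℝ} (hf : Measurable f) {X : ℕ → Ω → E}
    (hX : ∀ i, Measurable (X i)) (hstat : Stationary P X) (s : ℕ) :
    IdentDistrib (fun ω => f (shift s (path X ω))) (fun ω => f (path X ω)) P P := by
  have h : IdentDistrib (fun ω => shift s (path X ω)) (path X) P P :=
    ⟨((measurable_shift s).comp (measurable_path hX)).aemeasurable,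
      (measurable_path hX).aemeasurable, map_path_add hX hstat s⟩
  exact h.comp hf

end Blocks

/-! ### Finiteness and perturbation of the pressures. -/

section Pressure

variable {Ω : Type*} [MeasurableSpace Ω] {E : Type*} [MeasurableSpace E] {d : ℕ}
  {P : Measure Ω} {X : ℕ → Ω → E}
  {S S' : ℕ → (ℕ → E) → EuclideanSpace ℝ (Fin d)}

/-- `Λ_n` as a real-valued function. -/
noncomputable def realLambdaN (P : Measure Ω) (X : ℕ → Ω → E)
    (S : ℕ → (ℕ → E) → EuclideanSpace ℝ (Fin d)) (n : ℕ) (l : EuclideanSpace ℝ (Fin d)) : ℝ :=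
  Real.log (∫ ω, Real.exp (inner ℝ l (S n (path X ω))) ∂P) / n

theorem lambdaN_eq_coe [NeZero P] {n : ℕ} {l : EuclideanSpace ℝ (Fin d)}
    (h : Integrable (fun ω => Real.exp (inner ℝ l (S n (path X ω)))) P) :
    LambdaN P X S n l = (realLambdaN P X S n l : EReal) := by
  rw [LambdaN, realLambdaN, ← ofReal_integral_eq_lintegral_ofReal h
    (Eventually.of_forall fun ω => (Real.exp_pos _).le),
    ENNReal.log_ofReal_of_pos (integral_exp_pos h), EReal.coe_div]
  rfl

theorem measurable_exp_inner (hX : ∀ i, Measurable (X i)) {n : ℕ} (hS : Measurable (S n))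
    (l : EuclideanSpace ℝ (Fin d)) :
    Measurable fun ω => Real.exp (inner ℝ l (S n (path X ω))) :=
  (((hS.comp (measurable_path hX)).const_inner)).exp

theorem integrable_of_lambdaN_ne_top (hX : ∀ i, Measurable (X i)) {n : ℕ} (hn : 1 ≤ n)
    (hS : Measurable (S n)) {l : EuclideanSpace ℝ (Fin d)} (h : LambdaN P X S n l ≠ ⊤) :
    Integrable (fun ω => Real.exp (inner ℝ l (S n (path X ω)))) P := by
  rw [← lintegral_ofReal_ne_top_iff_integrable
    (measurable_exp_inner hX hS l).aestronglyMeasurable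
    (Eventually.of_forall fun ω => (Real.exp_pos _).le)]
  intro htop
  apply h
  rw [LambdaN, htop, ENNReal.log_top]
  exact EReal.top_div_of_pos_ne_top (by exact_mod_cast hn) (EReal.natCast_ne_top n)

theorem tendsto_lambdaN {D : Set (EuclideanSpace ℝ (Fin d))} (hA1 : HasFiniteLimitOn P X S D)
    {l : EuclideanSpace ℝ (Fin d)} (hl : l ∈ D) :
    Tendsto (fun n => LambdaN P X S n l) atTop (𝓝 (LambdaReal P X S l : EReal)) ∧
      LambdaLim P X S l = (LambdaReal P X S l : EReal) := by
  obtain ⟨r, hr⟩ := hA1.2.2 l hl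
  have h : LambdaLim P X S l = (r : EReal) := hr.limsup_eq
  have h2 : LambdaReal P X S l = r := by rw [LambdaReal, h, EReal.toReal_coe]
  rw [h2]
  exact ⟨hr, h⟩

theorem lambdaLim_zero [IsProbabilityMeasure P] : LambdaLim P X S 0 = 0 := by
  have : Tendsto (fun n => LambdaN P X S n 0) atTop (𝓝 0) := by
    simp [LambdaN]
  exact this.limsup_eq

/-- At a point where `Λ` is finite and `δ_nΛ` is finite, `Λ_n` is finite and close to `Λ`. -/
theorem abs_sub_realLambdaN_le [NeZero P] (hX : ∀ i, Measurable (X i)) {n : ℕ} (hn : 1 ≤ n)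
    (hS : Measurable (S n)) {K : Set (EuclideanSpace ℝ (Fin d))} {l : EuclideanSpace ℝ (Fin d)}
    (hl : l ∈ K) (hlim : LambdaLim P X S l = (LambdaReal P X S l : EReal))
    (hδ : deltaLambda P X S K n ≠ ⊤) :
    Integrable (fun ω => Real.exp (inner ℝ l (S n (path X ω)))) P ∧
      |LambdaReal P X S l - realLambdaN P X S n l| ≤ (deltaLambda P X S K n).toReal := by
  have h1 : (LambdaLim P X S l - LambdaN P X S n l).abs ≤ deltaLambda P X S K n :=
    le_iSup₂ (f := fun l (_ : l ∈ K) => (LambdaLim P X S l - LambdaN P X S n l).abs) l hl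
  have hint : Integrable (fun ω => Real.exp (inner ℝ l (S n (path X ω)))) P := by
    refine integrable_of_lambdaN_ne_top hX hn hS fun htop => hδ ?_
    rw [htop, hlim, EReal.sub_top, EReal.abs_bot] at h1
    exact top_le_iff.1 h1
  refine ⟨hint, ?_⟩
  rw [hlim, lambdaN_eq_coe hint, ← EReal.coe_sub, EReal.abs_def] at h1
  exact (ENNReal.ofReal_le_iff_le_toReal hδ).1 h1

theorem norm_sub_le_of_approxErr {n : ℕ} (hn : 1 ≤ n) (h : approxErr S S' n ≠ ⊤) (z : ℕ → E) :
    ‖S n z - S' n z‖ ≤ n * (approxErr S S' n).toReal := by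
  have hn0 : (n : ℝ≥0∞) ≠ 0 := by exact_mod_cast (by omega : n ≠ 0)
  have h1 : ‖S n z - S' n z‖ₑ ≤ n * approxErr S S' n := by
    rw [approxErr, ENNReal.mul_div_cancel hn0 (ENNReal.natCast_ne_top n)]
    exact le_iSup (fun z => ‖S n z - S' n z‖ₑ) z
  have h2 := ENNReal.toReal_mono (ENNReal.mul_ne_top (ENNReal.natCast_ne_top n) h) h1
  rwa [toReal_enorm, ENNReal.toReal_mul, ENNReal.toReal_natCast] at h2

theorem abs_inner_sub_le {n : ℕ} (hn : 1 ≤ n) (h : approxErr S S' n ≠ ⊤)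
    (l : EuclideanSpace ℝ (Fin d)) (z : ℕ → E) :
    |inner ℝ l (S n z) - inner ℝ l (S' n z)| ≤ n * (‖l‖ * (approxErr S S' n).toReal) := by
  rw [← inner_sub_right]
  refine (abs_real_inner_le_norm _ _).trans ?_
  have := mul_le_mul_of_nonneg_left (norm_sub_le_of_approxErr hn h z) (norm_nonneg l)
  linarith

theorem deltaPhi_ne_top {B : Set (EuclideanSpace ℝ (Fin d))} (hB : Bornology.IsBounded B) {n : ℕ}
    (h : approxErr S S' n ≠ ⊤) : deltaPhi S S' B n ≠ ⊤ := by
  obtain ⟨R, hR⟩ := hB.exists_norm_le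
  refine ENNReal.mul_ne_top (ne_top_of_le_ne_top ENNReal.ofReal_ne_top
    (iSup₂_le fun l hl => ?_ : _ ≤ ENNReal.ofReal R)) h
  rw [← ofReal_norm]
  exact ENNReal.ofReal_le_ofReal (hR l hl)

theorem norm_mul_approxErr_le {B : Set (EuclideanSpace ℝ (Fin d))} (hB : Bornology.IsBounded B)
    {n : ℕ} (h : approxErr S S' n ≠ ⊤) {l : EuclideanSpace ℝ (Fin d)} (hl : l ∈ B) :
    ‖l‖ * (approxErr S S' n).toReal ≤ (deltaPhi S S' B n).toReal := by
  have h1 : ‖l‖ₑ * approxErr S S' n ≤ deltaPhi S S' B n := by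
    rw [deltaPhi]; gcongr
    exact le_iSup₂ (f := fun l (_ : l ∈ B) => ‖l‖ₑ) l hl
  have h2 := ENNReal.toReal_mono (deltaPhi_ne_top hB h) h1
  rwa [ENNReal.toReal_mul, toReal_enorm] at h2

theorem integrable_exp_inner_of_abs_sub_le {V V' : Ω → EuclideanSpace ℝ (Fin d)}
    (hV' : Measurable V') {l : EuclideanSpace ℝ (Fin d)} {c : ℝ}
    (hc : ∀ ω, |inner ℝ l (V ω) - inner ℝ l (V' ω)| ≤ c)
    (h : Integrable (fun ω => Real.exp (inner ℝ l (V ω))) P) :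
    Integrable (fun ω => Real.exp (inner ℝ l (V' ω))) P := by
  refine (h.const_mul (Real.exp c)).mono' (hV'.const_inner.exp).aestronglyMeasurable
    (Eventually.of_forall fun ω => ?_)
  rw [Real.norm_eq_abs, Real.abs_exp, ← Real.exp_add]
  gcongr
  linarith [(abs_le.1 (hc ω)).1]

/-- A perturbation by `c` in the exponent changes the integral by a factor at most `exp c`. Any
nonzero measure is allowed, since this serves both `P` and the counting measure on the blocks. -/
theorem abs_log_integral_exp_sub_le [NeZero P] {V V' : Ω → EuclideanSpace ℝ (Fin d)}
    {l : EuclideanSpace ℝ (Fin d)} {c : ℝ}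
    (hc : ∀ ω, |inner ℝ l (V ω) - inner ℝ l (V' ω)| ≤ c)
    (h : Integrable (fun ω => Real.exp (inner ℝ l (V ω))) P)
    (h' : Integrable (fun ω => Real.exp (inner ℝ l (V' ω))) P) :
    |Real.log (∫ ω, Real.exp (inner ℝ l (V ω)) ∂P) -
      Real.log (∫ ω, Real.exp (inner ℝ l (V' ω)) ∂P)| ≤ c := by
  have key : ∀ {V V' : Ω → EuclideanSpace ℝ (Fin d)},
      (∀ ω, |inner ℝ l (V ω) - inner ℝ l (V' ω)| ≤ c) →
      Integrable (fun ω => Real.exp (inner ℝ l (V ω))) P →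
      Integrable (fun ω => Real.exp (inner ℝ l (V' ω))) P →
      Real.log (∫ ω, Real.exp (inner ℝ l (V ω)) ∂P) ≤
        c + Real.log (∫ ω, Real.exp (inner ℝ l (V' ω)) ∂P) := fun {V V'} hc h h' => by
    rw [← Real.log_exp c, ← Real.log_mul (Real.exp_pos _).ne' (integral_exp_pos h').ne']
    refine Real.log_le_log (integral_exp_pos h) ?_
    rw [← integral_const_mul]
    refine integral_mono h (h'.const_mul _) fun ω => ?_
    simp only
    rw [← Real.exp_add]
    gcongr
    linarith [(abs_le.1 (hc ω)).2]
  have h1 := key hc h h'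
  have h2 := key (V := V') (V' := V) (fun ω => by rw [abs_sub_comm]; exact hc ω) h' h
  rw [abs_le]; constructor <;> linarith

end Pressure

/-! ### The convex domain of a Laplace transform. -/

section Convexity

variable {F : Type*} [NormedAddCommGroup F] [InnerProductSpace ℝ F]

theorem convex_integrable_exp_inner {α : Type*} [MeasurableSpace α] (μ : Measure α) {V : α → F}
    (hV : ∀ l : F, AEStronglyMeasurable (fun x => Real.exp (inner ℝ l (V x))) μ) :
    Convex ℝ {l : F | Integrable (fun x => Real.exp (inner ℝ l (V x))) μ} := by
  intro x hx y hy a b ha hb hab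
  simp only [Set.mem_ofPred_eq] at hx hy ⊢
  refine ((hx.const_mul a).add (hy.const_mul b)).mono' (hV _) (Eventually.of_forall fun z => ?_)
  rw [Real.norm_eq_abs, Real.abs_exp, inner_add_left, real_inner_smul_left, real_inner_smul_left]
  exact convexOn_exp.2 (Set.mem_univ _) (Set.mem_univ _) ha hb hab

end Convexity

/-! ### The limit pressure, the summability condition in real numbers, and the moment ratio. -/

section Pressure

variable {Ω : Type*} [MeasurableSpace Ω] {E : Type*} [MeasurableSpace E] {d : ℕ}
  {P : Measure Ω} [IsProbabilityMeasure P] {X : ℕ → Ω → E}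
  {S S' : ℕ → (ℕ → E) → EuclideanSpace ℝ (Fin d)} {D : Set (EuclideanSpace ℝ (Fin d))}

theorem tendsto_realLambdaN (hX : ∀ i, Measurable (X i)) (hS : ∀ n, 1 ≤ n → Measurable (S n))
    (hA1 : HasFiniteLimitOn P X S D) {l : EuclideanSpace ℝ (Fin d)} (hl : l ∈ D) :
    (∀ᶠ n in atTop, Integrable (fun ω => Real.exp (inner ℝ l (S n (path X ω)))) P) ∧
      Tendsto (fun n => realLambdaN P X S n l) atTop (𝓝 (LambdaReal P X S l)) := by
  have h := (tendsto_lambdaN hA1 hl).1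
  have hint : ∀ᶠ n in atTop, Integrable (fun ω => Real.exp (inner ℝ l (S n (path X ω)))) P := by
    filter_upwards [h.eventually_ne (EReal.coe_ne_top _), eventually_ge_atTop 1] with n hn hn1
    exact integrable_of_lambdaN_ne_top hX hn1 (hS n hn1) hn
  refine ⟨hint, ?_⟩
  rw [← EReal.tendsto_coe]
  refine h.congr' ?_
  filter_upwards [hint] with n hn
  exact lambdaN_eq_coe hn

/-- A pointwise limit of functions that are convex where finite. Needed for `D²Λ ≥ 0`, hence for the
sign of `ξ₂`. -/
theorem convexOn_lambdaReal (hX : ∀ i, Measurable (X i)) (hS : ∀ n, 1 ≤ n → Measurable (S n))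
    (hA1 : HasFiniteLimitOn P X S D) : ConvexOn ℝ D (LambdaReal P X S) := by
  refine ⟨hA1.1, fun x hx y hy a b ha hb hab => ?_⟩
  obtain ⟨ix, tx⟩ := tendsto_realLambdaN hX hS hA1 hx
  obtain ⟨iy, ty⟩ := tendsto_realLambdaN hX hS hA1 hy
  obtain ⟨-, tz⟩ := tendsto_realLambdaN hX hS hA1 (hA1.1 hx hy ha hb hab)
  refine le_of_tendsto_of_tendsto tz ((tx.const_mul a).add (ty.const_mul b)) ?_
  filter_upwards [ix, iy, eventually_ge_atTop 1] with n hnx hny hn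
  have hconv := (convexOn_log_integral_exp (μ := P) (V := fun ω => S n (path X ω))
    (convex_integrable_exp_inner P fun l =>
      (measurable_exp_inner hX (hS n hn) l).aestronglyMeasurable) fun l hl => hl).2 hnx hny ha hb hab
  have hn0 : (0 : ℝ) ≤ n := by positivity
  calc realLambdaN P X S n (a • x + b • y) ≤ _ := div_le_div_of_nonneg_right hconv hn0
    _ = a * realLambdaN P X S n x + b * realLambdaN P X S n y := by
      simp only [realLambdaN, smul_eq_mul]; ring

theorem inner_gradient_eq (f : EuclideanSpace ℝ (Fin d) → ℝ) (l v : EuclideanSpace ℝ (Fin d)) :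
    inner ℝ v (gradient f l) = fderiv ℝ f l v := by
  rw [real_inner_comm, gradient, InnerProductSpace.toDual_symm_apply]

/-- Only the easy half of Fenchel's equality is needed: test the supremum defining `Λ^*(∇Λ(l))` at
`l` itself. -/
theorem le_lambdaStarSup {A : Set (EuclideanSpace ℝ (Fin d))} {l : EuclideanSpace ℝ (Fin d)}
    (hl : l ∈ A) (hlim : LambdaLim P X S l = (LambdaReal P X S l : EReal)) :
    ((fderiv ℝ (LambdaReal P X S) l l - LambdaReal P X S l : ℝ) : EReal) ≤
      LambdaStarSup P X S A := by
  refine le_trans ?_ (le_iSup₂ (f := fun l (_ : l ∈ A) =>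
    LambdaStar P X S (gradient (LambdaReal P X S) l)) l hl)
  refine le_trans (le_of_eq ?_) (le_iSup (fun l' : EuclideanSpace ℝ (Fin d) =>
    ((inner ℝ l' (gradient (LambdaReal P X S) l) : ℝ) : EReal) - LambdaLim P X S l') l)
  rw [hlim, inner_gradient_eq, EReal.coe_sub]

/-- Test the supremum at `0`, where `Λ` vanishes. -/
theorem lambdaStarSup_nonneg {A : Set (EuclideanSpace ℝ (Fin d))} (hA : A.Nonempty) :
    0 ≤ LambdaStarSup P X S A := by
  obtain ⟨l, hl⟩ := hA
  refine le_trans ?_ (le_iSup₂ (f := fun l (_ : l ∈ A) =>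
    LambdaStar P X S (gradient (LambdaReal P X S) l)) l hl)
  refine le_trans (le_of_eq ?_) (le_iSup (fun l' : EuclideanSpace ℝ (Fin d) =>
    ((inner ℝ l' (gradient (LambdaReal P X S) l) : ℝ) : EReal) - LambdaLim P X S l') 0)
  rw [lambdaLim_zero, inner_zero_left]
  simp

theorem xi2_nonneg (hX : ∀ i, Measurable (X i)) (hS : ∀ n, 1 ≤ n → Measurable (S n))
    (hA1 : HasFiniteLimitOn P X S D) (hC2 : ContDiffOn ℝ 2 (LambdaReal P X S) D)
    {A : Set (EuclideanSpace ℝ (Fin d))} (hA : A.Nonempty) (hAD : A ⊆ D) :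
    0 ≤ xi2 P X S A := by
  obtain ⟨l, hl⟩ := hA
  refine le_trans ?_ (le_iSup₂ (f := fun l (_ : l ∈ A) =>
    ((1 / 2 * fderiv ℝ (fderiv ℝ (LambdaReal P X S)) l l l : ℝ) : EReal)) l hl)
  have := fderiv_fderiv_nonneg_of_convexOn hA1.2.1 hC2 (convexOn_lambdaReal hX hS hA1)
    (hAD hl) l
  exact_mod_cast (by positivity)

/-- The ingredients of the summability condition as real numbers. -/
theorem exists_real_bc (hX : ∀ i, Measurable (X i)) (hS : ∀ n, 1 ≤ n → Measurable (S n))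
    (hA1 : HasFiniteLimitOn P X S D) (hC2 : ContDiffOn ℝ 2 (LambdaReal P X S) D)
    {B K : Set (EuclideanSpace ℝ (Fin d))} (hB : B.Nonempty) (hBK : B ⊆ K) (hK : K ⊆ D)
    {k : ℕ → ℕ} {ε : ℕ → ℝ} (hεpos : ∀ n, 1 ≤ n → 0 < ε n)
    (hBC : ∑' n : ℕ, bcTerm P X S S' B K k ε (n + 1) < ∞) :
    ∃ a x : ℝ, 0 ≤ a ∧ a ≤ x ∧
      (∀ l ∈ B, fderiv ℝ (LambdaReal P X S) l l - LambdaReal P X S l ≤ a) ∧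
      (∀ l ∈ K, 1 / 2 * fderiv ℝ (fderiv ℝ (LambdaReal P X S)) l l l ≤ x) ∧
      (∀ n, 1 ≤ n → deltaTot P X S S' K n ≠ ⊤) ∧
      Summable fun n : ℕ => Real.exp (-Real.sqrt (ε n) * (Real.log (k n) - n * a)) *
        ε n ^ (-((d : ℝ) + 3 / 2)) *
        Real.exp (3 * n * (x * ε n + (deltaTot P X S S' K n).toReal)) := by
  have hterm : ∀ n, 1 ≤ n → bcTerm P X S S' B K k ε n ≠ ⊤ := fun n hn => by
    obtain ⟨m, rfl⟩ := Nat.exists_eq_add_of_le' hn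
    exact ENNReal.ne_top_of_tsum_ne_top hBC.ne m
  have hKne : K.Nonempty := hB.mono hBK
  have hLB : 0 ≤ LambdaStarSup P X S B := lambdaStarSup_nonneg hB
  have hLK : 0 ≤ LambdaStarSup P X S K := lambdaStarSup_nonneg hKne
  have hx2 : 0 ≤ xi2 P X S K := xi2_nonneg hX hS hA1 hC2 hKne hK
  have hLBK : LambdaStarSup P X S B ≤ LambdaStarSup P X S K := biSup_mono hBK
  have hxiL : LambdaStarSup P X S K ≤ xi P X S K := le_add_of_nonneg_right hx2
  have hxi2 : xi2 P X S K ≤ xi P X S K := le_add_of_nonneg_left hLK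
  have hxi0 : 0 ≤ xi P X S K := hLK.trans hxiL
  have hCnn : ∀ n : ℕ, 1 ≤ n → 0 ≤ 3 * (n : EReal) *
      (xi P X S K * ((ε n : ℝ) : EReal) + ((deltaTot P X S S' K n : ℝ≥0∞) : EReal)) :=
    fun n hn => mul_nonneg (mul_nonneg (by norm_num) (by positivity))
      (add_nonneg (mul_nonneg hxi0 (EReal.coe_nonneg.2 (hεpos n hn).le))
        (EReal.coe_ennreal_nonneg _))
  -- A finite product in `ℝ≥0∞` excludes infinite factors only if no factor is `0`, so each
  -- exponential must first be shown to be nonzero.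
  have hApos : ∀ n : ℕ, 1 ≤ n → -((Real.sqrt (ε n) : ℝ) : EReal) *
      (((Real.log (k n) : ℝ) : EReal) - (n : EReal) * LambdaStarSup P X S B) ≠ ⊥ := fun n hn h => by
    have h1 : ((Real.log (k n) : ℝ) : EReal) - (n : EReal) * LambdaStarSup P X S B ≤
        ((Real.log (k n) : ℝ) : EReal) :=
      (EReal.sub_le_sub le_rfl (mul_nonneg (by positivity) hLB)).trans (by simp)
    rw [EReal.neg_mul, EReal.neg_eq_bot_iff] at h
    have h2 : ((Real.sqrt (ε n) : ℝ) : EReal) *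
        (((Real.log (k n) : ℝ) : EReal) - (n : EReal) * LambdaStarSup P X S B) ≤
        ((Real.sqrt (ε n) * Real.log (k n) : ℝ) : EReal) := by
      rw [EReal.coe_mul]
      exact mul_le_mul_of_nonneg_left h1 (EReal.coe_nonneg.2 (Real.sqrt_nonneg _))
    rw [h, top_le_iff] at h2
    exact EReal.coe_ne_top _ h2
  have hmid : ∀ n, 1 ≤ n → ENNReal.ofReal (ε n ^ (-((d : ℝ) + 3 / 2))) ≠ 0 := fun n hn => by
    rw [ne_eq, ENNReal.ofReal_eq_zero, not_le]
    exact Real.rpow_pos_of_pos (hεpos n hn) _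
  have hCtop : ∀ n : ℕ, 1 ≤ n → 3 * (n : EReal) *
      (xi P X S K * ((ε n : ℝ) : EReal) + ((deltaTot P X S S' K n : ℝ≥0∞) : EReal)) ≠ ⊤ :=
    fun n hn h => hterm n hn (by
      rw [bcTerm, h, EReal.exp_top]
      exact ENNReal.mul_top (mul_ne_zero (by simpa using hApos n hn) (hmid n hn)))
  have hAtop : ∀ n : ℕ, 1 ≤ n → -((Real.sqrt (ε n) : ℝ) : EReal) *
      (((Real.log (k n) : ℝ) : EReal) - (n : EReal) * LambdaStarSup P X S B) ≠ ⊤ :=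
    fun n hn h => hterm n hn (by
      rw [bcTerm, h, EReal.exp_top, ENNReal.top_mul (hmid n hn)]
      refine ENNReal.top_mul fun h0 => ?_
      rw [EReal.exp_eq_zero_iff] at h0
      have := hCnn n hn
      rw [h0] at this
      simp at this)
  have h3n : ∀ n : ℕ, 1 ≤ n → (0 : EReal) < 3 * (n : EReal) := fun n hn => by
    have : (3 : EReal) * (n : EReal) = ((3 * n : ℝ) : EReal) := by push_cast; rfl
    rw [this, EReal.coe_pos]
    have : (1 : ℝ) ≤ n := by exact_mod_cast hn
    linarith
  have hxitop : xi P X S K ≠ ⊤ := fun h => hCtop 1 le_rfl (by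
    rw [h, EReal.top_mul_coe_of_pos (hεpos 1 le_rfl),
      EReal.top_add_of_ne_bot (EReal.coe_ennreal_ne_bot _), EReal.mul_top_of_pos (h3n 1 le_rfl)])
  have hδtop : ∀ n, 1 ≤ n → deltaTot P X S S' K n ≠ ⊤ := fun n hn h => hCtop n hn (by
    rw [h, EReal.coe_ennreal_top, EReal.add_top_of_ne_bot, EReal.mul_top_of_pos (h3n n hn)]
    intro h0
    have h1 : (0 : EReal) ≤ xi P X S K * ((ε n : ℝ) : EReal) :=
      mul_nonneg hxi0 (EReal.coe_nonneg.2 (hεpos n hn).le)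
    rw [h0] at h1
    simp at h1)
  have hLtop : LambdaStarSup P X S B ≠ ⊤ := fun h =>
    hxitop (top_le_iff.1 (h ▸ hLBK.trans hxiL))
  have ha : LambdaStarSup P X S B = ((LambdaStarSup P X S B).toReal : EReal) :=
    (EReal.coe_toReal hLtop (fun h => by rw [h] at hLB; simp at hLB)).symm
  have hx : xi P X S K = ((xi P X S K).toReal : EReal) :=
    (EReal.coe_toReal hxitop (fun h => by rw [h] at hxi0; simp at hxi0)).symm
  set a := (LambdaStarSup P X S B).toReal with hadef
  set x := (xi P X S K).toReal with hxdef
  refine ⟨a, x, ?_, ?_, fun l hl => ?_, fun l hl => ?_, hδtop, ?_⟩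
  · rw [ha] at hLB; exact_mod_cast hLB
  · have := hLBK.trans hxiL
    rw [ha, hx] at this; exact_mod_cast this
  · have := le_lambdaStarSup hl (tendsto_lambdaN hA1 (hK (hBK hl))).2
    rw [ha] at this; exact EReal.coe_le_coe_iff.1 this
  · have := (le_iSup₂ (f := fun l (_ : l ∈ K) =>
      ((1 / 2 * fderiv ℝ (fderiv ℝ (LambdaReal P X S)) l l l : ℝ) : EReal)) l hl).trans hxi2
    rw [hx] at this; exact EReal.coe_le_coe_iff.1 this
  · rw [← summable_nat_add_iff 1]
    have heq : ∀ n : ℕ, bcTerm P X S S' B K k ε (n + 1) =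
        ENNReal.ofReal (Real.exp (-Real.sqrt (ε (n + 1)) *
          (Real.log (k (n + 1)) - (n + 1 : ℕ) * a)) * ε (n + 1) ^ (-((d : ℝ) + 3 / 2)) *
        Real.exp (3 * (n + 1 : ℕ) * (x * ε (n + 1) +
          (deltaTot P X S S' K (n + 1)).toReal))) := fun n => by
      have hpos := hεpos (n + 1) (by omega)
      have e1 : ((deltaTot P X S S' K (n + 1) : ℝ≥0∞) : EReal) =
          (((deltaTot P X S S' K (n + 1)).toReal : ℝ) : EReal) :=
        (EReal.coe_ennreal_toReal (hδtop (n + 1) (by omega))).symm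
      rw [ENNReal.ofReal_mul (by positivity), ENNReal.ofReal_mul (by positivity), bcTerm, ha, hx,
        e1, ← EReal.exp_coe, ← EReal.exp_coe]
      congr 2
    have hs : ∑' n : ℕ, bcTerm P X S S' B K k ε (n + 1) ≠ ⊤ := hBC.ne
    simp_rw [heq] at hs
    have := ENNReal.summable_toReal hs
    refine this.congr fun n => ?_
    have hpos := hεpos (n + 1) (by omega)
    exact ENNReal.toReal_ofReal (by positivity)

/-- The ratio of moments of the exponential block variables. -/
theorem moment_ratio_le (hX : ∀ i, Measurable (X i)) (hA1 : HasFiniteLimitOn P X S D)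
    (hC2 : ContDiffOn ℝ 2 (LambdaReal P X S) D) {K : Set (EuclideanSpace ℝ (Fin d))} (hK : K ⊆ D)
    (hKb : Bornology.IsBounded K) {n : ℕ} (hn : 1 ≤ n) (hS : Measurable (S n))
    (hS' : Measurable (S' n)) (happ : approxErr S S' n ≠ ⊤) (hδ : deltaTot P X S S' K n ≠ ⊤)
    {l : EuclideanSpace ℝ (Fin d)} {a x τ : ℝ} (hτ0 : 0 ≤ τ) (hτ : τ ≤ 1 / 4) (hx0 : 0 ≤ x)
    (hseg : ∀ t ∈ Set.Icc 0 τ, l + t • l ∈ K)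
    (ha : fderiv ℝ (LambdaReal P X S) l l - LambdaReal P X S l ≤ a)
    (hx : ∀ l ∈ K, 1 / 2 * fderiv ℝ (fderiv ℝ (LambdaReal P X S)) l l l ≤ x) :
    Integrable (fun ω => Real.exp (inner ℝ l (S' n (path X ω)))) P ∧
    Integrable (fun ω => Real.exp (inner ℝ l (S' n (path X ω))) ^ (1 + τ)) P ∧
    (∫ ω, Real.exp (inner ℝ l (S' n (path X ω))) ^ (1 + τ) ∂P) /
      (∫ ω, Real.exp (inner ℝ l (S' n (path X ω))) ∂P) ^ (1 + τ) ≤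
      Real.exp (n * (τ * a + τ ^ 2 * x + 5 / 2 * (deltaTot P X S S' K n).toReal)) := by
  have hn0 : (1 : ℝ) ≤ n := by exact_mod_cast hn
  have hlK : l ∈ K := by simpa using hseg 0 ⟨le_rfl, hτ0⟩
  have hl'K : l + τ • l ∈ K := hseg τ ⟨hτ0, le_rfl⟩
  have hδL : deltaLambda P X S K n ≠ ⊤ := fun h => hδ (by rw [deltaTot, h, top_add])
  have hδP : deltaPhi S S' K n ≠ ⊤ := fun h => hδ (by rw [deltaTot, h, add_top])
  have hδeq : (deltaTot P X S S' K n).toReal =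
      (deltaLambda P X S K n).toReal + (deltaPhi S S' K n).toReal :=
    ENNReal.toReal_add hδL hδP
  obtain ⟨i1, b1⟩ := abs_sub_realLambdaN_le hX hn hS hlK (tendsto_lambdaN hA1 (hK hlK)).2 hδL
  obtain ⟨i2, b2⟩ := abs_sub_realLambdaN_le hX hn hS hl'K (tendsto_lambdaN hA1 (hK hl'K)).2 hδL
  have hSm : Measurable fun ω => S' n (path X ω) := hS'.comp (measurable_path hX)
  have c1 := fun ω => abs_inner_sub_le hn happ l (path X ω)
  have c2 := fun ω => abs_inner_sub_le hn happ (l + τ • l) (path X ω)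
  have j1 := integrable_exp_inner_of_abs_sub_le hSm c1 i1
  have j2 := integrable_exp_inner_of_abs_sub_le hSm c2 i2
  have d1 := abs_log_integral_exp_sub_le c1 i1 j1
  have d2 := abs_log_integral_exp_sub_le c2 i2 j2
  have hpow : ∀ ω, Real.exp (inner ℝ l (S' n (path X ω))) ^ (1 + τ) =
      Real.exp (inner ℝ (l + τ • l) (S' n (path X ω))) := fun ω => by
    rw [← Real.exp_mul, inner_add_left, real_inner_smul_left]; congr 1; ring
  simp_rw [hpow]
  refine ⟨j1, j2, ?_⟩
  have p1 := integral_exp_pos j1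
  have p2 := integral_exp_pos j2
  -- Expansion along the ray through `l`. Homogeneity turns the bound on `D²Λ(p)(p, p)` at `p = (1 +
  -- t) l` into one on `D²Λ(p)(l, l)`, smaller by the factor `(1 + t)²`.
  have htaylor : LambdaReal P X S (l + τ • l) ≤ LambdaReal P X S l +
      τ * fderiv ℝ (LambdaReal P X S) l l + τ ^ 2 * x := by
    refine le_taylor_of_fderiv_le hA1.2.1 hC2 hτ0 (fun t ht => hK (hseg t ht)) fun t ht => ?_
    have h1 := hx _ (hseg t ht)
    have h2 : l + t • l = (1 + t) • l := by rw [add_smul, one_smul]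
    have h3 : fderiv ℝ (fderiv ℝ (LambdaReal P X S)) (l + t • l) (l + t • l) (l + t • l) =
        (1 + t) ^ 2 * fderiv ℝ (fderiv ℝ (LambdaReal P X S)) (l + t • l) l l := by
      conv_lhs => rw [h2]
      rw [map_smul, map_smul, ← h2]
      simp; ring
    rw [h3] at h1
    by_contra hcon
    push Not at hcon
    have h4 : 0 < fderiv ℝ (fderiv ℝ (LambdaReal P X S)) (l + t • l) l l := by linarith
    nlinarith [ht.1, mul_nonneg ht.1 h4.le, mul_nonneg (mul_nonneg ht.1 ht.1) h4.le]
  rw [div_le_iff₀ (Real.rpow_pos_of_pos p1 _), Real.rpow_def_of_pos p1, ← Real.exp_add,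
    ← Real.log_le_iff_le_exp p2]
  have f1 := norm_mul_approxErr_le hKb happ hlK
  have f2 := norm_mul_approxErr_le hKb happ hl'K
  set φ := (deltaPhi S S' K n).toReal with hφ
  set δ := (deltaLambda P X S K n).toReal with hδ'
  have hδ0 : 0 ≤ δ := ENNReal.toReal_nonneg
  have hφ0 : 0 ≤ φ := ENNReal.toReal_nonneg
  rw [hδeq]
  have g1 : n * (‖l‖ * (approxErr S S' n).toReal) ≤ n * φ := by gcongr
  have g2 : n * (‖l + τ • l‖ * (approxErr S S' n).toReal) ≤ n * φ := by gcongr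
  set A1 := Real.log (∫ ω, Real.exp (inner ℝ l (S n (path X ω))) ∂P) with hA1'
  set A2 := Real.log (∫ ω, Real.exp (inner ℝ (l + τ • l) (S n (path X ω))) ∂P) with hA2'
  have q1 : realLambdaN P X S n l = A1 / n := rfl
  have q2 : realLambdaN P X S n (l + τ • l) = A2 / n := rfl
  rw [q1] at b1
  rw [q2] at b2
  have r1 : n * (LambdaReal P X S l - δ) ≤ A1 := by
    have := (abs_le.1 b1).2
    rw [← le_div_iff₀' (by linarith)]; linarith
  have r2 : A2 ≤ n * (LambdaReal P X S (l + τ • l) + δ) := by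
    have := (abs_le.1 b2).1
    rw [← div_le_iff₀' (by linarith)]; linarith
  have s1 := (abs_le.1 d1).2
  have s2 := (abs_le.1 d2).1
  have key : LambdaReal P X S (l + τ • l) - (1 + τ) * LambdaReal P X S l ≤ τ * a + τ ^ 2 * x := by
    nlinarith
  have t1 : n * (LambdaReal P X S l - δ) - n * φ ≤
      Real.log (∫ ω, Real.exp (inner ℝ l (S' n (path X ω))) ∂P) := by linarith
  -- The errors enter once at `(1 + τ) l` and `1 + τ` times at `l`; as `τ ≤ 1/4` their total weight
  -- `2 + τ` is below `5/2`.
  have t2 := mul_le_mul_of_nonneg_left t1 (show 0 ≤ 1 + τ by linarith)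
  have t3 := mul_le_mul_of_nonneg_left key (show (0 : ℝ) ≤ n by linarith)
  have t4 : τ * (n * δ) ≤ 1 / 4 * (n * δ) := by gcongr
  have t5 : τ * (n * φ) ≤ 1 / 4 * (n * φ) := by gcongr
  have t6 : 0 ≤ n * δ := by positivity
  have t7 : 0 ≤ n * φ := by positivity
  nlinarith

end Pressure

/-! ### The empirical pressure as a log-Laplace transform. -/

section Empirical

variable {Ω : Type*} [MeasurableSpace Ω] {E : Type*} [MeasurableSpace E] {d : ℕ}
  {P : Measure Ω} {X : ℕ → Ω → E}
  {S S' : ℕ → (ℕ → E) → EuclideanSpace ℝ (Fin d)} {k : ℕ → ℕ}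

theorem lambdaEmp_eq {n : ℕ} (hn : 1 ≤ n) (ω : Ω) (l : EuclideanSpace ℝ (Fin d)) :
    LambdaEmp X S k n ω l = Real.log ((k n : ℝ)⁻¹ * ∑ i ∈ Finset.range (k n),
      Real.exp (inner ℝ l (S n (shift (i * n) (path X ω))))) / n := by
  have hn0 : (n : ℝ) ≠ 0 := by exact_mod_cast (by omega : n ≠ 0)
  rw [LambdaEmp, empMeasure, integral_smul_measure, integral_finsetSum_measure]
  · simp only [integral_dirac, real_inner_smul_right, mul_inv_cancel_left₀ hn0, smul_eq_mul,
      ENNReal.toReal_inv, ENNReal.toReal_natCast]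
    ring
  · exact fun i _ => integrable_dirac (by simp)

/-- With the counting measure on the blocks, convexity and stability under perturbation come from
the same lemmas as for `Λ_n`. -/
theorem lambdaEmp_eq_count {n : ℕ} (hn : 1 ≤ n) (hk : 0 < k n) (ω : Ω)
    (l : EuclideanSpace ℝ (Fin d)) :
    LambdaEmp X S k n ω l = (Real.log (∫ i : Fin (k n),
      Real.exp (inner ℝ l (S n (shift (i * n) (path X ω)))) ∂Measure.count) -
        Real.log (k n)) / n := by
  have hk0 : (k n : ℝ) ≠ 0 := by exact_mod_cast hk.ne'
  have : Nonempty (Fin (k n)) := ⟨⟨0, hk⟩⟩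
  rw [lambdaEmp_eq hn, integral_count, Finset.sum_range, Real.log_mul (inv_ne_zero hk0),
    Real.log_inv]
  · ring
  · exact (Finset.sum_pos (fun i _ => Real.exp_pos _) Finset.univ_nonempty).ne'

theorem neZero_count {m : ℕ} (hm : 0 < m) : NeZero (Measure.count : Measure (Fin m)) :=
  ⟨fun h => by
    have := congrArg (fun μ : Measure (Fin m) => μ {⟨0, hm⟩}) h
    simp at this⟩

theorem convexOn_lambdaEmp {n : ℕ} (hn : 1 ≤ n) (hk : 0 < k n) (ω : Ω) :
    ConvexOn ℝ Set.univ (LambdaEmp X S k n ω) := by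
  have := neZero_count hk
  have h := convexOn_log_integral_exp (μ := (Measure.count : Measure (Fin (k n))))
    (V := fun i : Fin (k n) => S n (shift (i * n) (path X ω))) convex_univ
    fun l _ => Integrable.of_finite
  have h2 := (h.add_const (-Real.log (k n))).smul (show (0 : ℝ) ≤ (n : ℝ)⁻¹ by positivity)
  refine h2.congr fun l _ => ?_
  simp only [lambdaEmp_eq_count hn hk, smul_eq_mul, Pi.add_apply]
  ring

theorem abs_lambdaEmp_sub_le {n : ℕ} (hn : 1 ≤ n) (hk : 0 < k n) (happ : approxErr S S' n ≠ ⊤)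
    (ω : Ω) (l : EuclideanSpace ℝ (Fin d)) :
    |LambdaEmp X S k n ω l - LambdaEmp X S' k n ω l| ≤ ‖l‖ * (approxErr S S' n).toReal := by
  have := neZero_count hk
  have hn0 : (0 : ℝ) < n := by exact_mod_cast hn
  have h := abs_log_integral_exp_sub_le (P := (Measure.count : Measure (Fin (k n))))
    (V := fun i : Fin (k n) => S n (shift (i * n) (path X ω)))
    (V' := fun i : Fin (k n) => S' n (shift (i * n) (path X ω))) (l := l)
    (fun i => abs_inner_sub_le hn happ l _) Integrable.of_finite Integrable.of_finite
  rw [lambdaEmp_eq_count hn hk, lambdaEmp_eq_count hn hk, ← sub_div, sub_sub_sub_cancel_right,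
    abs_div, abs_of_pos hn0, div_le_iff₀ hn0]
  linarith

theorem abs_realLambdaN_sub_le [NeZero P] (hX : ∀ i, Measurable (X i)) {n : ℕ} (hn : 1 ≤ n)
    (hS' : Measurable (S' n)) (happ : approxErr S S' n ≠ ⊤) {l : EuclideanSpace ℝ (Fin d)}
    (hint : Integrable (fun ω => Real.exp (inner ℝ l (S n (path X ω)))) P) :
    |realLambdaN P X S n l - realLambdaN P X S' n l| ≤ ‖l‖ * (approxErr S S' n).toReal := by
  have hn0 : (0 : ℝ) < n := by exact_mod_cast hn
  have hc := fun ω => abs_inner_sub_le hn happ l (path X ω)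
  have h := abs_log_integral_exp_sub_le hc hint
    (integrable_exp_inner_of_abs_sub_le (hS'.comp (measurable_path hX)) hc hint)
  rw [realLambdaN, realLambdaN, ← sub_div, abs_div, abs_of_pos hn0, div_le_iff₀ hn0]
  linarith

end Empirical

/-! ### Deviations of the empirical pressure on finite sets. -/

section Deviation

variable {Ω : Type*} [MeasurableSpace Ω] {E : Type*} [MeasurableSpace E] {d : ℕ}
  {P : Measure Ω} [IsProbabilityMeasure P] {X : ℕ → Ω → E}
  {S S' : ℕ → (ℕ → E) → EuclideanSpace ℝ (Fin d)} {k : ℕ → ℕ} {ε : ℕ → ℝ}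

/-- The second-order part of `t(1 + t)` comes from the lower side, `log(1 - t) ≥ -t - t²` for small
`t`. This is the source of `ε_n(1 + ε_n)/n`. -/
theorem abs_log_sub_log_le {y e t : ℝ} (he : 0 < e) (ht0 : 0 < t) (ht : t ≤ 1 / 4)
    (h : |y - e| ≤ t * e) : |Real.log y - Real.log e| ≤ t * (1 + t) := by
  obtain ⟨h1, h2⟩ := abs_le.1 h
  have hy : 0 < y := by nlinarith
  rw [← Real.log_div hy.ne' he.ne', abs_le]
  have hye : 0 < y / e := div_pos hy he
  constructor
  · have h3 : 1 - t ≤ y / e := by rw [le_div_iff₀ he]; linarith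
    rw [Real.le_log_iff_exp_le hye, Real.exp_neg]
    refine le_trans ?_ h3
    have h4 := Real.quadratic_le_exp_of_nonneg (show 0 ≤ t * (1 + t) by positivity)
    rw [inv_le_iff_one_le_mul₀ (Real.exp_pos _)]
    have h5 : 1 ≤ (1 - t) * (1 + t * (1 + t) + (t * (1 + t)) ^ 2 / 2) := by
      have h6 : 0 ≤ t ^ 2 * (1 - t - t ^ 2 - t ^ 3) := by
        have : t ^ 2 ≤ 1 / 4 * (1 / 4) := by nlinarith
        have : t ^ 3 ≤ 1 / 4 := by nlinarith [sq_nonneg t]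
        have : 0 ≤ 1 - t - t ^ 2 - t ^ 3 := by linarith
        positivity
      nlinarith
    exact h5.trans (mul_le_mul_of_nonneg_left h4 (by linarith))
  · have h3 : y / e ≤ 1 + t := by rw [div_le_iff₀ he]; linarith
    calc Real.log (y / e) ≤ y / e - 1 := Real.log_le_sub_one_of_pos hye
      _ ≤ t := by linarith
      _ ≤ _ := by nlinarith

/-- Deviation inequality for the empirical exponential moments. -/
theorem measureReal_empirical_deviation_le (hX : ∀ i, Measurable (X i)) (hstat : Stationary P X)
    {n : ℕ} (hS' : Measurable (S' n)) (hdep : DependsOn (S' n) (Set.Iio (2 * n)))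
    {m q : ℕ} (hm : 1 ≤ m) (hq : 2 ≤ q) {τ t : ℝ} (hτ : 0 < τ) (hτ1 : τ ≤ 1) (ht : 0 < t)
    {l : EuclideanSpace ℝ (Fin d)}
    (hint : Integrable (fun ω => Real.exp (inner ℝ l (S' n (path X ω)))) P)
    (hp : Integrable (fun ω => Real.exp (inner ℝ l (S' n (path X ω))) ^ (1 + τ)) P) :
    P.real {ω | t * ∫ ω, Real.exp (inner ℝ l (S' n (path X ω))) ∂P <
        |(m : ℝ)⁻¹ * ∑ i ∈ Finset.range m, Real.exp (inner ℝ l (S' n (shift (i * n) (path X ω)))) -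
          ∫ ω, Real.exp (inner ℝ l (S' n (path X ω))) ∂P|} ≤
      21 * (((q : ℝ) / m) ^ τ * t ^ (-(1 + τ)) *
        ((∫ ω, Real.exp (inner ℝ l (S' n (path X ω))) ^ (1 + τ) ∂P) /
          (∫ ω, Real.exp (inner ℝ l (S' n (path X ω))) ∂P) ^ (1 + τ))) +
      9 * (alphaMix P X ((q - 2) * n + 1) * (m : ℝ) ^ 2 / (q : ℝ) ^ 2) := by
  let f : (ℕ → E) → ℝ := fun z => Real.exp (inner ℝ l (S' n z))
  have hf : Measurable f := hS'.const_inner.exp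
  have hfdep : DependsOn f (Set.Iio (2 * n)) := fun x y hxy => by
    simp only [f]; rw [hdep hxy]
  have h0 : (fun ω => f (shift (0 * n) (path X ω))) = fun ω => f (path X ω) := by
    funext ω; rw [zero_mul]; rfl
  have h := measureReal_abs_average_sub_gt_le (P := P)
    (Y := fun i ω => f (shift (i * n) (path X ω))) (k := m) (q := q) (τ := τ) (ε := t)
    (a := alphaMix P X ((q - 2) * n + 1))
    (fun i => hf.comp ((measurable_shift _).comp (measurable_path hX)))
    (fun i ω => (Real.exp_pos _).le)
    (fun i => by
      simp only [h0]
      exact identDistrib_block hf hX hstat _) hm (by omega) hτ hτ1 ht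
  simp only [congrFun h0] at h
  exact h hp hint (integral_exp_pos hint)
    fun i j hij A B hA hB => abs_measureReal_block_le hf hfdep X hq hij hA hB

/-- Almost surely, eventually the empirical pressure is close to the pressure on sets whose
cardinalities do not grow too fast. -/
theorem ae_eventually_abs_lambdaEmp_sub_le (hX : ∀ i, Measurable (X i)) (hstat : Stationary P X)
    (hA2 : StretchedExpMixing P X) (hA3 : LocalApprox S S') (hk : ∀ n, 1 ≤ n → 0 < k n)
    (hεpos : ∀ n, 1 ≤ n → 0 < ε n) (hε : Tendsto ε atTop (𝓝 0)) {a x : ℝ} {δ : ℕ → ℝ}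
    (ha : 0 ≤ a) (hax : a ≤ x) (hδ : ∀ n, 1 ≤ n → 0 ≤ δ n)
    (hsum : Summable fun n : ℕ => Real.exp (-Real.sqrt (ε n) * (Real.log (k n) - n * a)) *
      ε n ^ (-((d : ℝ) + 3 / 2)) * Real.exp (3 * n * (x * ε n + δ n)))
    {B : Set (EuclideanSpace ℝ (Fin d))}
    (hmom : ∀ᶠ n in atTop, ∀ l ∈ B,
      Integrable (fun ω => Real.exp (inner ℝ l (S' n (path X ω)))) P ∧
      Integrable (fun ω => Real.exp (inner ℝ l (S' n (path X ω))) ^ (1 + Real.sqrt (ε n))) P ∧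
      (∫ ω, Real.exp (inner ℝ l (S' n (path X ω))) ^ (1 + Real.sqrt (ε n)) ∂P) /
        (∫ ω, Real.exp (inner ℝ l (S' n (path X ω))) ∂P) ^ (1 + Real.sqrt (ε n)) ≤
        Real.exp (n * (Real.sqrt (ε n) * a + ε n * x + 5 / 2 * δ n)))
    (N : ℕ → Finset (EuclideanSpace ℝ (Fin d))) (hN : ∀ n, ∀ l ∈ N n, l ∈ B) {C : ℝ}
    (hcard : ∀ᶠ n in atTop, ((N n).card : ℝ) ≤ C * ε n ^ (-((d : ℝ) + 1 / 4))) :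
    ∀ᵐ ω ∂P, ∀ᶠ n in atTop, ∀ l ∈ N n,
      |LambdaEmp X S' k n ω l - realLambdaN P X S' n l| ≤ ε n * (1 + ε n) / n := by
  obtain ⟨γ, θ, hγ, hθ, hO⟩ := hA2
  obtain ⟨Cα, hCα⟩ := hO.bound
  obtain ⟨m₀, hm₀⟩ := eventually_atTop.1 hCα
  obtain ⟨hs1, hs2⟩ := summable_of_bc d hγ hθ ha hax hk hεpos hε hδ hsum
  let bad : ℕ → EuclideanSpace ℝ (Fin d) → Set Ω := fun n l =>
    {ω | ε n * ∫ ω, Real.exp (inner ℝ l (S' n (path X ω))) ∂P <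
        |(k n : ℝ)⁻¹ * ∑ i ∈ Finset.range (k n),
          Real.exp (inner ℝ l (S' n (shift (i * n) (path X ω)))) -
          ∫ ω, Real.exp (inner ℝ l (S' n (path X ω))) ∂P|}
  set u : ℕ → ℝ := fun n => ((mixingGap γ θ (Real.log (k n)) n : ℝ) / k n) ^ Real.sqrt (ε n) *
        ε n ^ (-(1 + Real.sqrt (ε n))) *
        Real.exp (n * (Real.sqrt (ε n) * a + ε n * x + 5 / 2 * δ n)) with hu
  set v : ℕ → ℝ := fun n => Real.exp (-γ *
      (((mixingGap γ θ (Real.log (k n)) n - 2) * n + 1 : ℕ) : ℝ) ^ θ) * (k n : ℝ) ^ 2 with hv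
  have hsmall : ∀ᶠ n in atTop, ε n ≤ 1 / 4 :=
    (hε.eventually_lt_const (show (0 : ℝ) < 1 / 4 by norm_num)).mono fun n h => h.le
  have hbad : ∀ᶠ n in atTop, ∀ l ∈ B, P.real (bad n l) ≤ 21 * u n + 9 * |Cα| * v n := by
    filter_upwards [hmom, hsmall, eventually_ge_atTop 1, eventually_ge_atTop m₀] with n h1 h2 h3 h4
      l hl
    obtain ⟨i1, i2, hr⟩ := h1 l hl
    have hε0 := hεpos n h3
    set q := mixingGap γ θ (Real.log (k n)) n with hq
    -- Since `q ≥ 3`, the time gap `(q - 2) n + 1` exceeds `n`, so the asymptotic mixing bound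
    -- applies for large `n` whatever `k(n)` is.
    have hq3 : 3 ≤ q := by rw [hq, mixingGap]; omega
    have hα : alphaMix P X ((q - 2) * n + 1) ≤
        |Cα| * Real.exp (-γ * (((q - 2) * n + 1 : ℕ) : ℝ) ^ θ) := by
      have h5 : m₀ ≤ (q - 2) * n + 1 := by
        have : 1 * n ≤ (q - 2) * n := Nat.mul_le_mul_right n (by omega)
        omega
      have h6 := hm₀ _ h5
      rw [Real.norm_eq_abs, Real.norm_eq_abs, Real.abs_exp] at h6
      refine (le_abs_self _).trans (h6.trans ?_)
      gcongr
      exact le_abs_self _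
    have hτ1 : Real.sqrt (ε n) ≤ 1 := by
      rw [Real.sqrt_le_left zero_le_one]; linarith
    refine (measureReal_empirical_deviation_le hX hstat (hA3.1 n h3).1 (hA3.1 n h3).2
      (hk n h3) (by omega : 2 ≤ q) (Real.sqrt_pos.2 hε0) hτ1 hε0 i1 i2).trans ?_
    refine add_le_add ?_ ?_
    · simp only [hu]; gcongr
    · have hq1 : (1 : ℝ) ≤ (q : ℝ) ^ 2 := by
        have : (3 : ℝ) ≤ q := by exact_mod_cast hq3
        nlinarith
      calc 9 * (alphaMix P X ((q - 2) * n + 1) * (k n : ℝ) ^ 2 / (q : ℝ) ^ 2)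
          ≤ 9 * (|Cα| * Real.exp (-γ * (((q - 2) * n + 1 : ℕ) : ℝ) ^ θ) * (k n : ℝ) ^ 2 /
            (q : ℝ) ^ 2) := by gcongr
        _ ≤ 9 * (|Cα| * Real.exp (-γ * (((q - 2) * n + 1 : ℕ) : ℝ) ^ θ) * (k n : ℝ) ^ 2) := by
            gcongr
            exact div_le_self (by positivity) hq1
        _ = 9 * |Cα| * v n := by simp only [hv]; ring
  have hunion : Summable fun n => P.real (⋃ l ∈ N n, bad n l) := by
    refine Summable.of_norm_bounded_eventually_nat
      ((hs1.mul_left (|C| * 21)).add (hs2.mul_left (|C| * (9 * |Cα|)))) ?_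
    filter_upwards [hbad, hcard, eventually_ge_atTop 1] with n h1 h2 h3
    rw [Real.norm_eq_abs, abs_of_nonneg measureReal_nonneg]
    have hε0 := hεpos n h3
    have h4 : 0 ≤ 21 * u n + 9 * |Cα| * v n := by positivity
    calc P.real (⋃ l ∈ N n, bad n l) ≤ ∑ l ∈ N n, P.real (bad n l) :=
          measureReal_biUnion_finset_le _ _
      _ ≤ ∑ _l ∈ N n, (21 * u n + 9 * |Cα| * v n) :=
          Finset.sum_le_sum fun l hl => h1 l (hN n l hl)
      _ = (N n).card * (21 * u n + 9 * |Cα| * v n) := by rw [Finset.sum_const, nsmul_eq_mul]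
      _ ≤ (|C| * ε n ^ (-((d : ℝ) + 1 / 4))) * (21 * u n + 9 * |Cα| * v n) := by
          gcongr
          refine h2.trans ?_
          gcongr
          exact le_abs_self C
      _ = _ := by simp only [hu, hv]; ring
  have hBC : ∑' n, P (⋃ l ∈ N n, bad n l) ≠ ⊤ := by
    have := hunion.tsum_ofReal_ne_top
    simpa [ofReal_measureReal] using this
  filter_upwards [ae_eventually_notMem hBC] with ω hω
  filter_upwards [hω, hmom, hsmall, eventually_ge_atTop 1] with n h1 h2 h3 h4 l hl
  simp only [Set.mem_iUnion, not_exists] at h1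
  have h5 : ¬ (ε n * ∫ ω, Real.exp (inner ℝ l (S' n (path X ω))) ∂P <
        |(k n : ℝ)⁻¹ * ∑ i ∈ Finset.range (k n),
          Real.exp (inner ℝ l (S' n (shift (i * n) (path X ω)))) -
          ∫ ω, Real.exp (inner ℝ l (S' n (path X ω))) ∂P|) := h1 l hl
  rw [not_lt] at h5
  have hn0 : (0 : ℝ) < n := by exact_mod_cast h4
  have h6 := abs_log_sub_log_le (integral_exp_pos (h2 l (hN n l hl)).1) (hεpos n h4) h3 h5
  rw [lambdaEmp_eq h4, realLambdaN, ← sub_div, abs_div, abs_of_pos hn0]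
  gcongr

end Deviation

/-! ### Local Lipschitz bounds from convexity. -/

section Lipschitz

variable {Ω : Type*} [MeasurableSpace Ω] {E : Type*} [MeasurableSpace E] {d : ℕ}
  {P : Measure Ω} [IsProbabilityMeasure P] {X : ℕ → Ω → E}
  {S' : ℕ → (ℕ → E) → EuclideanSpace ℝ (Fin d)} {k : ℕ → ℕ}

/-- A lower bound at the centre suffices: convexity at the midpoint of `x` and its reflection `2x₀ -
x` gives `h x ≥ 2 h x₀ - M`. -/
theorem lipschitzOnWith_ball_of_convexOn {F : Type*} [NormedAddCommGroup F] [NormedSpace ℝ F]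
    {h : F → ℝ} {x₀ : F} {r M m : ℝ} (hr : 0 < r) (hh : ConvexOn ℝ (Metric.ball x₀ r) h)
    (hM : ∀ x ∈ Metric.ball x₀ r, h x ≤ M) (hm : -m ≤ h x₀) :
    LipschitzOnWith (2 * (|M| + 2 * |m|) / (r / 2)).toNNReal h (Metric.ball x₀ (r / 2)) := by
  have hb : ∀ x, dist x x₀ < r → |h x| ≤ |M| + 2 * |m| := fun x hx => by
    have hx' : (2 : ℝ) • x₀ - x ∈ Metric.ball x₀ r := by
      have h1 : (2 : ℝ) • x₀ - x - x₀ = -(x - x₀) := by rw [two_smul]; abel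
      rwa [Metric.mem_ball, dist_eq_norm, h1, norm_neg, ← dist_eq_norm]
    have h1 := hh.2 (Metric.mem_ball.2 hx) hx' (show (0 : ℝ) ≤ 1 / 2 by norm_num)
      (show (0 : ℝ) ≤ 1 / 2 by norm_num) (by norm_num)
    have h2 : (1 / 2 : ℝ) • x + (1 / 2 : ℝ) • ((2 : ℝ) • x₀ - x) = x₀ := by
      rw [smul_sub, smul_smul]; norm_num
    rw [h2, smul_eq_mul, smul_eq_mul] at h1
    have h3 := hM _ hx'
    have h4 := hM x (Metric.mem_ball.2 hx)
    rw [abs_le]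
    constructor <;> linarith [le_abs_self M, le_abs_self m, abs_nonneg m]
  have := hh.lipschitzOnWith_of_abs_le (ε := r / 2) (by positivity) hb
  rwa [sub_half] at this

/-- Markov's inequality and the Borel-Cantelli lemma bound the empirical pressure from above. -/
theorem ae_eventually_lambdaEmp_le (hX : ∀ i, Measurable (X i)) (hstat : Stationary P X)
    (hS' : ∀ n, 1 ≤ n → Measurable (S' n)) (hk : ∀ n, 1 ≤ n → 0 < k n)
    {l : EuclideanSpace ℝ (Fin d)}
    (hint : ∀ᶠ n in atTop, Integrable (fun ω => Real.exp (inner ℝ l (S' n (path X ω)))) P) :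
    ∀ᵐ ω ∂P, ∀ᶠ n in atTop, LambdaEmp X S' k n ω l ≤ realLambdaN P X S' n l + 1 := by
  let e : ℕ → ℝ := fun n => ∫ ω, Real.exp (inner ℝ l (S' n (path X ω))) ∂P
  let A : ℕ → Ω → ℝ := fun n ω => (k n : ℝ)⁻¹ * ∑ i ∈ Finset.range (k n),
    Real.exp (inner ℝ l (S' n (shift (i * n) (path X ω))))
  -- Losing a factor `exp n` costs only `1` in the pressure, while Markov's inequality gives the
  -- summable probability `exp(-n)`; no mixing is used.
  let bad : ℕ → Set Ω := fun n => {ω | Real.exp n * e n ≤ A n ω}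
  have hbad : ∀ᶠ n in atTop, P.real (bad n) ≤ Real.exp (-n) := by
    filter_upwards [hint, eventually_ge_atTop 1] with n hn hn1
    have hk0 : (k n : ℝ) ≠ 0 := by exact_mod_cast (hk n hn1).ne'
    have hid : ∀ i, IdentDistrib (fun ω => Real.exp (inner ℝ l (S' n (shift (i * n) (path X ω)))))
        (fun ω => Real.exp (inner ℝ l (S' n (path X ω)))) P P := fun i =>
      identDistrib_block (f := fun z => Real.exp (inner ℝ l (S' n z)))
        (hS' n hn1).const_inner.exp hX hstat _
    have he : 0 < e n := integral_exp_pos hn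
    have h1 := mul_meas_ge_le_integral_of_nonneg (μ := P) (f := A n)
      (Eventually.of_forall fun ω => mul_nonneg (by positivity)
        (Finset.sum_nonneg fun i _ => (Real.exp_pos _).le))
      ((integrable_finsetSum _ fun i _ => (hid i).integrable_iff.2 hn).const_mul _)
      (Real.exp n * e n)
    have h2 : ∫ ω, A n ω ∂P = e n := by
      simp only [A]
      rw [integral_const_mul, integral_finsetSum _ fun i _ => (hid i).integrable_iff.2 hn,
        Finset.sum_congr rfl fun i _ => (hid i).integral_eq, Finset.sum_const, Finset.card_range,
        nsmul_eq_mul, inv_mul_cancel_left₀ hk0]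
    rw [h2] at h1
    have h3 : Real.exp n * P.real (bad n) * e n ≤ 1 * e n := by
      simp only [bad]; linarith
    have h4 := le_of_mul_le_mul_right h3 he
    rw [Real.exp_neg, ← one_div, le_div_iff₀ (Real.exp_pos _)]
    linarith
  have hsum : Summable fun n => P.real (bad n) :=
    Summable.of_norm_bounded_eventually_nat Real.summable_exp_neg_nat (by
      filter_upwards [hbad] with n hn
      rwa [Real.norm_eq_abs, abs_of_nonneg measureReal_nonneg])
  have hBC : ∑' n, P (bad n) ≠ ⊤ := by
    have := hsum.tsum_ofReal_ne_top
    simpa [ofReal_measureReal] using this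
  filter_upwards [ae_eventually_notMem hBC] with ω hω
  filter_upwards [hω, hint, eventually_ge_atTop 1] with n h1 h2 h3
  have hn0 : (0 : ℝ) < n := by exact_mod_cast h3
  have he : 0 < e n := integral_exp_pos h2
  have h4 : A n ω < Real.exp n * e n := not_le.1 h1
  have hA : 0 < A n ω := mul_pos (inv_pos.2 (by exact_mod_cast hk n h3))
    (Finset.sum_pos (fun i _ => Real.exp_pos _) ⟨0, Finset.mem_range.2 (hk n h3)⟩)
  have h5 := Real.log_le_log hA h4.le
  rw [Real.log_mul (Real.exp_pos _).ne' he.ne', Real.log_exp] at h5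
  rw [lambdaEmp_eq h3, realLambdaN]
  calc Real.log (A n ω) / n ≤ (n + Real.log (e n)) / n := by gcongr
    _ = Real.log (e n) / n + 1 := by field_simp; ring

end Lipschitz

/-! ### From points to compact sets. -/

section Uniform

variable {Ω : Type*} [MeasurableSpace Ω] {E : Type*} [MeasurableSpace E] {d : ℕ}
  {P : Measure Ω} [IsProbabilityMeasure P] {X : ℕ → Ω → E}
  {S S' : ℕ → (ℕ → E) → EuclideanSpace ℝ (Fin d)} {k : ℕ → ℕ} {ε : ℕ → ℝ}

theorem convexOn_realLambdaN {n : ℕ} {s : Set (EuclideanSpace ℝ (Fin d))} (hs : Convex ℝ s)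
    (hint : ∀ l ∈ s, Integrable (fun ω => Real.exp (inner ℝ l (S n (path X ω)))) P) :
    ConvexOn ℝ s (realLambdaN P X S n) := by
  have h := (convexOn_log_integral_exp hs hint).smul (show (0 : ℝ) ≤ (n : ℝ)⁻¹ by positivity)
  refine h.congr fun l _ => ?_
  simp only [realLambdaN, smul_eq_mul]
  ring

/-- Near a point of the domain the pressures and the empirical pressures are equi-Lipschitz. -/
theorem exists_ae_eventually_lipschitzOnWith (hX : ∀ i, Measurable (X i))
    (hstat : Stationary P X) (hS' : ∀ n, 1 ≤ n → Measurable (S' n)) (hk : ∀ n, 1 ≤ n → 0 < k n)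
    {x₀ : EuclideanSpace ℝ (Fin d)} {ρ : ℝ} (hρ : 0 < ρ) {Λ : EuclideanSpace ℝ (Fin d) → ℝ}
    (hint : ∀ᶠ n in atTop, ∀ l ∈ Metric.ball x₀ ρ,
      Integrable (fun ω => Real.exp (inner ℝ l (S' n (path X ω)))) P)
    (hlim : ∀ l ∈ Metric.ball x₀ ρ, Tendsto (fun n => realLambdaN P X S' n l) atTop (𝓝 (Λ l)))
    (hcenter : ∀ᵐ ω ∂P, ∀ᶠ n in atTop,
      |LambdaEmp X S' k n ω x₀ - realLambdaN P X S' n x₀| ≤ 1) :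
    ∃ s : ℝ, 0 < s ∧ ∃ C : NNReal, ∀ᵐ ω ∂P, ∀ᶠ n in atTop,
      LipschitzOnWith C (LambdaEmp X S' k n ω) (Metric.ball x₀ s) ∧
      LipschitzOnWith C (realLambdaN P X S' n) (Metric.ball x₀ s) := by
  -- A convex function on a simplex is bounded by its values at the vertices. These may lie outside
  -- `B`, where only the crude upper bound by Markov's inequality is at hand; the centre supplies
  -- the lower bound.
  obtain ⟨b, hb1, hb2⟩ := exists_mem_interior_convexHull_affineBasis (Metric.ball_mem_nhds x₀ hρ)
  obtain ⟨r, hr0, hr⟩ := Metric.mem_nhds_iff.1 (mem_interior_iff_mem_nhds.1 hb1)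
  have hbρ : ∀ i, b i ∈ Metric.ball x₀ ρ := fun i =>
    hb2 (subset_convexHull ℝ _ (Set.mem_range_self i))
  obtain ⟨M, hM⟩ := (Set.finite_range fun i => Λ (b i)).bddAbove
  have hMi : ∀ i, Λ (b i) ≤ M := fun i => hM (Set.mem_range_self i)
  refine ⟨r / 2, by positivity,
    (2 * (|M + 2| + 2 * |(|Λ x₀| + 2)|) / (r / 2)).toNNReal, ?_⟩
  have hup : ∀ᵐ ω ∂P, ∀ i, ∀ᶠ n in atTop,
      LambdaEmp X S' k n ω (b i) ≤ realLambdaN P X S' n (b i) + 1 := ae_all_iff.2 fun i =>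
    ae_eventually_lambdaEmp_le hX hstat hS' hk (hint.mono fun n hn => hn _ (hbρ i))
  have hgup : ∀ᶠ n in atTop, ∀ i, realLambdaN P X S' n (b i) ≤ M + 1 := by
    rw [eventually_all]
    intro i
    filter_upwards [(hlim _ (hbρ i)).eventually_lt_const
      (show Λ (b i) < M + 1 by linarith [hMi i])] with n hn
    exact hn.le
  have hglow : ∀ᶠ n in atTop, -(|Λ x₀| + 1) ≤ realLambdaN P X S' n x₀ := by
    filter_upwards [(hlim _ (Metric.mem_ball_self hρ)).eventually_const_lt
      (show -(|Λ x₀| + 1) < Λ x₀ by linarith [neg_abs_le (Λ x₀)])] with n hn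
    exact hn.le
  have hball : Metric.ball x₀ r ⊆ Metric.ball x₀ ρ := hr.trans hb2
  have hle : ∀ {h : EuclideanSpace ℝ (Fin d) → ℝ} {c : ℝ}, ConvexOn ℝ (Metric.ball x₀ ρ) h →
      (∀ i, h (b i) ≤ c) → ∀ x ∈ Metric.ball x₀ r, h x ≤ c := fun {h c} hh hc x hx => by
    obtain ⟨y, ⟨i, rfl⟩, hy⟩ := hh.exists_ge_of_mem_convexHull
      (Set.range_subset_iff.2 hbρ) (hr hx)
    exact hy.trans (hc i)
  filter_upwards [hup, hcenter] with ω h1 h2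
  filter_upwards [eventually_all.2 h1, h2, hgup, hglow, hint, eventually_ge_atTop 1] with n h3 h4
    h5 h6 h7 h8
  have cf : ConvexOn ℝ (Metric.ball x₀ ρ) (LambdaEmp X S' k n ω) :=
    (convexOn_lambdaEmp h8 (hk n h8) ω).subset (Set.subset_univ _) (convex_ball _ _)
  have cg : ConvexOn ℝ (Metric.ball x₀ ρ) (realLambdaN P X S' n) :=
    convexOn_realLambdaN (convex_ball _ _) h7
  refine ⟨lipschitzOnWith_ball_of_convexOn hr0 (cf.subset hball (convex_ball _ _))
    (hle cf fun i => ?_) ?_, lipschitzOnWith_ball_of_convexOn hr0 (cg.subset hball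
    (convex_ball _ _)) (hle cg fun i => ?_) ?_⟩
  · linarith [h3 i, h5 i]
  · linarith [(abs_le.1 h4).1]
  · linarith [h5 i]
  · linarith

/-- Local Lipschitz bounds along a sequence of pairs of functions are uniform on compact sets. -/
theorem exists_ae_eventually_abs_sub_le_mul_dist {F : Type*} [PseudoMetricSpace F]
    {f : ℕ → Ω → F → ℝ} {g : ℕ → F → ℝ} {B : Set F} (hB : IsCompact B)
    (hloc : ∀ x₀ ∈ B, ∃ s : ℝ, 0 < s ∧ ∃ C : NNReal, ∀ᵐ ω ∂P, ∀ᶠ n in atTop,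
      LipschitzOnWith C (f n ω) (Metric.ball x₀ s) ∧ LipschitzOnWith C (g n) (Metric.ball x₀ s)) :
    ∃ s : ℝ, 0 < s ∧ ∃ C : NNReal, ∀ᵐ ω ∂P, ∀ᶠ n in atTop, ∀ x ∈ B, ∀ y, dist x y < s →
      |f n ω x - f n ω y| ≤ C * dist x y ∧ |g n x - g n y| ≤ C * dist x y := by
  -- The constants `s` and `C` are deterministic, and compactness combines only finitely many null
  -- sets.
  refine hB.induction_on (p := fun A => ∃ s : ℝ, 0 < s ∧ ∃ C : NNReal, ∀ᵐ ω ∂P, ∀ᶠ n in atTop,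
    ∀ x ∈ A, ∀ y, dist x y < s →
      |f n ω x - f n ω y| ≤ C * dist x y ∧ |g n x - g n y| ≤ C * dist x y) ?_ ?_ ?_ ?_
  · exact ⟨1, one_pos, 0, by simp⟩
  · rintro A A' hAA' ⟨s, hs, C, h⟩
    refine ⟨s, hs, C, ?_⟩
    filter_upwards [h] with ω hω
    filter_upwards [hω] with n hn x hx
    exact hn x (hAA' hx)
  · rintro A A' ⟨s, hs, C, h⟩ ⟨s', hs', C', h'⟩
    refine ⟨min s s', lt_min hs hs', max C C', ?_⟩
    filter_upwards [h, h'] with ω hω hω'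
    filter_upwards [hω, hω'] with n hn hn' x hx y hxy
    have e1 : (C : ℝ) * dist x y ≤ ((max C C' : NNReal) : ℝ) * dist x y := by
      gcongr; exact le_max_left _ _
    have e2 : (C' : ℝ) * dist x y ≤ ((max C C' : NNReal) : ℝ) * dist x y := by
      gcongr; exact le_max_right _ _
    rcases hx with hx | hx
    · exact (hn x hx y (hxy.trans_le (min_le_left _ _))).imp (fun h => h.trans e1)
        fun h => h.trans e1
    · exact (hn' x hx y (hxy.trans_le (min_le_right _ _))).imp (fun h => h.trans e2)
        fun h => h.trans e2
  · intro x₀ hx₀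
    obtain ⟨s, hs, C, h⟩ := hloc x₀ hx₀
    refine ⟨Metric.ball x₀ (s / 2),
      mem_nhdsWithin_of_mem_nhds (Metric.ball_mem_nhds _ (by positivity)), s / 2, by positivity, C, ?_⟩
    filter_upwards [h] with ω hω
    filter_upwards [hω] with n hn x hx y hxy
    rw [Metric.mem_ball] at hx
    have hx' : x ∈ Metric.ball x₀ s := by rw [Metric.mem_ball]; linarith
    have hy' : y ∈ Metric.ball x₀ s := by
      rw [Metric.mem_ball]
      have := dist_triangle y x x₀
      rw [dist_comm y x] at this
      linarith
    have h1 := hn.1.dist_le_mul x hx' y hy'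
    have h2 := hn.2.dist_le_mul x hx' y hy'
    rw [Real.dist_eq] at h1 h2
    exact ⟨h1, h2⟩

/-- The error terms that come from the approximations of `Λ` by `Λ_n` and of `S` by `S'`. -/
theorem ofReal_abs_lambdaEmp_sub_lambdaReal_le (hX : ∀ i, Measurable (X i)) {n : ℕ} (hn : 1 ≤ n)
    (hk : 0 < k n) (hS : Measurable (S n)) (hS' : Measurable (S' n))
    (happ : approxErr S S' n ≠ ⊤) {B K : Set (EuclideanSpace ℝ (Fin d))}
    (hB : Bornology.IsBounded B) (hBK : B ⊆ K) (hδ : deltaLambda P X S K n ≠ ⊤)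
    {l : EuclideanSpace ℝ (Fin d)} (hl : l ∈ B)
    (hlim : LambdaLim P X S l = (LambdaReal P X S l : EReal)) {ω : Ω} {c : ℝ}
    (h : |LambdaEmp X S' k n ω l - realLambdaN P X S' n l| ≤ c) :
    ENNReal.ofReal |LambdaEmp X S k n ω l - LambdaReal P X S l| ≤
      ENNReal.ofReal c + deltaLambda P X S K n + 2 * deltaPhi S S' B n := by
  obtain ⟨hint, h1⟩ := abs_sub_realLambdaN_le hX hn hS (hBK hl) hlim hδ
  have h2 := abs_realLambdaN_sub_le hX hn hS' happ hint
  have h3 := abs_lambdaEmp_sub_le (X := X) hn hk happ ω l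
  have h4 := norm_mul_approxErr_le hB happ hl
  have h5 : |LambdaEmp X S k n ω l - LambdaReal P X S l| ≤
      c + (deltaLambda P X S K n).toReal + 2 * (deltaPhi S S' B n).toReal := by
    -- Replacing `S` by `S'` costs one `δ_nΦ` in the empirical pressure and one in `Λ_n`, whence the
    -- factor `2`.
    rw [abs_le] at *
    constructor <;> linarith
  have hc : 0 ≤ c := (abs_nonneg _).trans h
  refine (ENNReal.ofReal_le_ofReal h5).trans (le_of_eq ?_)
  rw [ENNReal.ofReal_add (by positivity) (by positivity), ENNReal.ofReal_add hc (by positivity),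
    ENNReal.ofReal_mul (by norm_num), ENNReal.ofReal_toReal hδ,
    ENNReal.ofReal_toReal (deltaPhi_ne_top hB happ)]
  norm_num

end Uniform

end LocalFluct

/-! ### The theorem. -/

open LocalFluct
theorem theorem2p4 {Ω : Type*} [MeasurableSpace Ω] (P : Measure Ω) [IsProbabilityMeasure P]
    {E : Type*} [MeasurableSpace E] {d : ℕ} (hd : 1 ≤ d)
    (X : ℕ → Ω → E) (hX : ∀ i, Measurable (X i)) (hstat : Stationary P X)
    (S S' : ℕ → (ℕ → E) → EuclideanSpace ℝ (Fin d)) (hS : ∀ n, 1 ≤ n → Measurable (S n))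
    (k : ℕ → ℕ) (hkpos : ∀ n, 1 ≤ n → 0 < k n) (hkmono : MonotoneOn k (Set.Ici 1))
    (D : Set (EuclideanSpace ℝ (Fin d)))
    (hA1 : HasFiniteLimitOn P X S D)
    (hA2 : StretchedExpMixing P X)
    (hA3 : LocalApprox S S')
    (hC2 : ContDiffOn ℝ 2 (LambdaReal P X S) D)
    (B : Set (EuclideanSpace ℝ (Fin d))) (hB : IsCompact B)
    (ρ : ℝ) (hρ : 0 < ρ) (hBρ : Metric.cthickening ρ B ⊆ D)
    (ε : ℕ → ℝ) (hεpos : ∀ n, 1 ≤ n → 0 < ε n) (hε : Tendsto ε atTop (𝓝 0))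
    (hBC : ∑' n : ℕ, bcTerm P X S S' B (Metric.cthickening ρ B) k ε (n + 1) < ∞) :
    (∀ η : ℝ, 0 < η → ∀ᵐ ω ∂P, ∀ᶠ n : ℕ in atTop, ∀ l ∈ B,
      ENNReal.ofReal |LambdaEmp X S k n ω l - LambdaReal P X S l| ≤
        (ENNReal.ofReal η + 2 * xi1 P X S B) * ENNReal.ofReal (ε n) +
          deltaLambda P X S (Metric.cthickening ρ B) n + 2 * deltaPhi S S' B n) ∧
    (∀ l : EuclideanSpace ℝ (Fin d), B = {l} → ∀ᵐ ω ∂P, ∀ᶠ n : ℕ in atTop,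
      ENNReal.ofReal |LambdaEmp X S k n ω l - LambdaReal P X S l| ≤
        ENNReal.ofReal (ε n * (1 + ε n) / n) +
          deltaLambda P X S (Metric.cthickening ρ B) n + 2 * deltaPhi S S' B n) := by
  -- An empty supremum in `EReal` is `⊥`, so the sign arguments need `B` nonempty.
  rcases B.eq_empty_or_nonempty with rfl | hBne
  · exact ⟨fun η _ => by simp, fun l h => absurd h.symm (Set.singleton_ne_empty l)⟩
  set K := Metric.cthickening ρ B with hK
  have hBK : B ⊆ K := Metric.self_subset_cthickening B
  have hBb : Bornology.IsBounded B := hB.isBounded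
  have hKb : Bornology.IsBounded K := hBb.cthickening
  have hS' : ∀ n, 1 ≤ n → Measurable (S' n) := fun n hn => (hA3.1 n hn).1
  obtain ⟨a, x, ha, hax, hstar, hxi, hδtop, hsum⟩ :=
    exists_real_bc hX hS hA1 hC2 hBne hBK hBρ hεpos hBC
  have hδL : ∀ n, 1 ≤ n → deltaLambda P X S K n ≠ ⊤ := fun n hn h =>
    hδtop n hn (by rw [deltaTot, h, top_add])
  have happ : ∀ᶠ n in atTop, approxErr S S' n ≠ ⊤ :=
    (hA3.2.eventually_lt_const ENNReal.zero_lt_top).mono fun n h => h.ne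
  have hsqrt : Tendsto (fun n => Real.sqrt (ε n)) atTop (𝓝 0) := by
    simpa [Function.comp_def] using (Real.continuous_sqrt.tendsto 0).comp hε
  obtain ⟨R, hR0, hR⟩ := hBb.exists_pos_norm_le
  have hmom : ∀ᶠ n in atTop, ∀ l ∈ B,
      Integrable (fun ω => Real.exp (inner ℝ l (S' n (path X ω)))) P ∧
      Integrable (fun ω => Real.exp (inner ℝ l (S' n (path X ω))) ^ (1 + Real.sqrt (ε n))) P ∧
      (∫ ω, Real.exp (inner ℝ l (S' n (path X ω))) ^ (1 + Real.sqrt (ε n)) ∂P) /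
        (∫ ω, Real.exp (inner ℝ l (S' n (path X ω))) ∂P) ^ (1 + Real.sqrt (ε n)) ≤
        Real.exp (n * (Real.sqrt (ε n) * a + ε n * x +
          5 / 2 * (deltaTot P X S S' K n).toReal)) := by
    filter_upwards [happ, hsqrt.eventually_lt_const (show (0 : ℝ) < 1 / 4 by norm_num),
      hsqrt.eventually_lt_const (show 0 < ρ / R by positivity), eventually_ge_atTop 1] with n h1 h2
      h3 h4 l hl
    have h5 := moment_ratio_le (P := P) (x := x) (a := a) hX hA1 hC2 hBρ hKb h4 (hS n h4)
      (hS' n h4) h1 (hδtop n h4) (Real.sqrt_nonneg (ε n)) h2.le (ha.trans hax)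
      (fun t ht => ?_) (hstar l hl) hxi
    · rwa [Real.sq_sqrt (hεpos n h4).le] at h5
    -- The ray from `l` to `(1 + √ε_n) l` stays in the `ρ`-neighbourhood once `√ε_n ≤ ρ / R`, with
    -- `R` a bound for the norms on `B`.
    · refine Metric.mem_cthickening_of_dist_le _ l ρ B hl ?_
      rw [dist_eq_norm, add_sub_cancel_left, norm_smul, Real.norm_eq_abs, abs_of_nonneg ht.1]
      calc t * ‖l‖ ≤ ρ / R * R := mul_le_mul (ht.2.trans h3.le) (hR l hl) (norm_nonneg _)
            (by positivity)
        _ = ρ := by field_simp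
  have hsmall : ∀ᶠ n in atTop, ε n ≤ 1 :=
    (hε.eventually_lt_const zero_lt_one).mono fun n h => h.le
  have hnet := fun (N : ℕ → Finset (EuclideanSpace ℝ (Fin d))) (hN : ∀ n, ∀ l ∈ N n, l ∈ B)
      (C : ℝ) (hcard : ∀ᶠ n in atTop, ((N n).card : ℝ) ≤ C * ε n ^ (-((d : ℝ) + 1 / 4))) =>
    ae_eventually_abs_lambdaEmp_sub_le hX hstat hA2 hA3 hkpos hεpos hε ha hax
      (fun n _ => ENNReal.toReal_nonneg) hsum hmom N hN hcard
  have hpoint : ∀ l ∈ B, ∀ᵐ ω ∂P, ∀ᶠ n in atTop,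
      |LambdaEmp X S' k n ω l - realLambdaN P X S' n l| ≤ ε n * (1 + ε n) / n := fun l hl => by
    have h := hnet (fun _ => {l}) (fun n l' hl' => by rwa [Finset.mem_singleton.1 hl']) 1 (by
      filter_upwards [hsmall, eventually_ge_atTop 1] with n h1 h2
      rw [Finset.card_singleton, Nat.cast_one, one_mul]
      exact Real.one_le_rpow_of_pos_of_le_one_of_nonpos (hεpos n h2) h1
        (by have : (0 : ℝ) ≤ d := by positivity
            linarith))
    filter_upwards [h] with ω hω
    filter_upwards [hω] with n hn
    exact hn l (Finset.mem_singleton_self l)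
  have hfinal : ∀ {l : EuclideanSpace ℝ (Fin d)} {n : ℕ} {ω : Ω} {c : ℝ}, l ∈ B → 1 ≤ n →
      approxErr S S' n ≠ ⊤ → |LambdaEmp X S' k n ω l - realLambdaN P X S' n l| ≤ c →
      ENNReal.ofReal |LambdaEmp X S k n ω l - LambdaReal P X S l| ≤
        ENNReal.ofReal c + deltaLambda P X S K n + 2 * deltaPhi S S' B n :=
    fun hl hn h1 h2 => ofReal_abs_lambdaEmp_sub_lambdaReal_le hX hn (hkpos _ hn) (hS _ hn)
      (hS' _ hn) h1 hBb hBK (hδL _ hn) hl (tendsto_lambdaN hA1 (hBρ (hBK hl))).2 h2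
  refine ⟨fun η hη => ?_, fun l hBl => ?_⟩
  swap
  · have hl : l ∈ B := by rw [hBl]; exact Set.mem_singleton l
    filter_upwards [hpoint l hl] with ω hω
    filter_upwards [hω, happ, eventually_ge_atTop 1] with n h1 h2 h3
    exact hfinal hl h3 h2 h1
  have hd0 : (0 : ℝ) < d := by exact_mod_cast hd
  obtain ⟨C, hC0, hC⟩ := exists_finset_net hBb
  -- The exponent `1 + 1/(4d)` turns `r^{-d}` into `ε^{-(d+1/4)}`, the cardinality that the
  -- summability condition allows, and makes the mesh `o(ε_n)`.
  have hex : ∀ n, ∃ N : Finset (EuclideanSpace ℝ (Fin d)), (∀ l ∈ N, l ∈ B) ∧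
      (0 < ε n → ε n ≤ 1 → (N.card : ℝ) ≤ C * ε n ^ (-((d : ℝ) + 1 / 4)) ∧
        ∀ l ∈ B, ∃ l' ∈ N, dist l l' ≤ ε n ^ (1 + 1 / (4 * (d : ℝ)))) := fun n => by
    by_cases h : 0 < ε n ∧ ε n ≤ 1
    · obtain ⟨N, h1, h2, h3⟩ := hC (ε n ^ (1 + 1 / (4 * (d : ℝ)))) (Real.rpow_pos_of_pos h.1 _)
        (Real.rpow_le_one h.1.le h.2 (by positivity))
      refine ⟨N, fun l hl => h1 hl, fun _ _ => ⟨h2.trans (le_of_eq ?_), h3⟩⟩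
      rw [← Real.rpow_mul h.1.le]
      congr 2
      field_simp
    · exact ⟨∅, by simp, fun h1 h2 => absurd ⟨h1, h2⟩ h⟩
  choose N hNB hN using hex
  have hgood := hnet N hNB C (by
    filter_upwards [hsmall, eventually_ge_atTop 1] with n h1 h2
    exact (hN n (hεpos n h2) h1).1)
  have hintK : ∀ᶠ n in atTop, ∀ l ∈ K,
      Integrable (fun ω => Real.exp (inner ℝ l (S n (path X ω)))) P ∧
      Integrable (fun ω => Real.exp (inner ℝ l (S' n (path X ω)))) P := by
    filter_upwards [happ, eventually_ge_atTop 1] with n h1 h2 l hl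
    have h3 := (abs_sub_realLambdaN_le hX h2 (hS n h2) hl
      (tendsto_lambdaN hA1 (hBρ hl)).2 (hδL n h2)).1
    exact ⟨h3, integrable_exp_inner_of_abs_sub_le ((hS' n h2).comp (measurable_path hX))
      (fun ω => abs_inner_sub_le h2 h1 l (path X ω)) h3⟩
  have happ0 : Tendsto (fun n => (approxErr S S' n).toReal) atTop (𝓝 0) := by
    simpa [Function.comp_def] using (ENNReal.tendsto_toReal ENNReal.zero_ne_top).comp hA3.2
  have hlim : ∀ l ∈ K, Tendsto (fun n => realLambdaN P X S' n l) atTop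
      (𝓝 (LambdaReal P X S l)) := fun l hl => by
    have h1 := (tendsto_realLambdaN hX hS hA1 (hBρ hl)).2
    have h2 : Tendsto (fun n => realLambdaN P X S n l - realLambdaN P X S' n l) atTop (𝓝 0) := by
      refine squeeze_zero_norm' ?_ (by simpa using happ0.const_mul ‖l‖)
      filter_upwards [happ, hintK, eventually_ge_atTop 1] with n h3 h4 h5
      exact abs_realLambdaN_sub_le hX h5 (hS' n h5) h3 (h4 l hl).1
    simpa using h1.sub h2
  have hdivn : Tendsto (fun n : ℕ => (1 + ε n) / n) atTop (𝓝 0) :=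
    (hε.const_add 1).div_atTop tendsto_natCast_atTop_atTop
  obtain ⟨s, hs, Cl, hLip⟩ := exists_ae_eventually_abs_sub_le_mul_dist (P := P)
    (f := fun n ω => LambdaEmp X S' k n ω) (g := fun n => realLambdaN P X S' n) hB
    fun x₀ hx₀ => by
      have hball : Metric.ball x₀ ρ ⊆ K := fun y hy =>
        Metric.mem_cthickening_of_dist_le y x₀ ρ B hx₀ (Metric.mem_ball.1 hy).le
      refine exists_ae_eventually_lipschitzOnWith hX hstat hS' hkpos hρ
        (hintK.mono fun n hn l hl => (hn l (hball hl)).2) (fun l hl => hlim l (hball hl)) ?_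
      filter_upwards [hpoint x₀ hx₀] with ω hω
      filter_upwards [hω, hsmall, hdivn.eventually_lt_const zero_lt_one, eventually_ge_atTop 1]
        with n h1 h2 h3 h4
      refine h1.trans ?_
      rw [mul_div_assoc]
      have := hεpos n h4
      have h5 : 0 ≤ (1 + ε n) / n := by positivity
      exact mul_le_one₀ h2 h5 h3.le
  have hr : Tendsto (fun n => ε n ^ (1 / (4 * (d : ℝ)))) atTop (𝓝 0) := by
    have h1 : (0 : ℝ) < 1 / (4 * (d : ℝ)) := by positivity
    have := hε.rpow_const (p := 1 / (4 * (d : ℝ))) (Or.inr h1.le)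
    rwa [Real.zero_rpow h1.ne'] at this
  have herr : Tendsto (fun n : ℕ => 2 * Cl * ε n ^ (1 / (4 * (d : ℝ))) + (1 + ε n) / n) atTop
      (𝓝 0) := by
    simpa using (hr.const_mul (2 * (Cl : ℝ))).add hdivn
  filter_upwards [hgood, hLip] with ω h1 h2
  filter_upwards [h1, h2, hsmall, happ, herr.eventually_lt_const hη, hr.eventually_lt_const hs,
    eventually_ge_atTop 1] with n h3 h4 h5 h6 h7 h8 h9 l hl
  have hε0 := hεpos n h9
  obtain ⟨l', hl'N, hl'⟩ := (hN n hε0 h5).2 l hl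
  have hrn : ε n ^ (1 + 1 / (4 * (d : ℝ))) = ε n * ε n ^ (1 / (4 * (d : ℝ))) := by
    rw [Real.rpow_add hε0, Real.rpow_one]
  rw [hrn] at hl'
  have hr0 : 0 < ε n ^ (1 / (4 * (d : ℝ))) := Real.rpow_pos_of_pos hε0 _
  have hdist : dist l l' < s :=
    (hl'.trans (mul_le_of_le_one_left hr0.le h5)).trans_lt h8
  obtain ⟨h10, h11⟩ := h4 l hl l' hdist
  have h12 := h3 l' hl'N
  have h13 : (Cl : ℝ) * dist l l' ≤ Cl * (ε n * ε n ^ (1 / (4 * (d : ℝ)))) := by gcongr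
  have h14 : |LambdaEmp X S' k n ω l - realLambdaN P X S' n l| ≤ η * ε n := by
    have h15 : |LambdaEmp X S' k n ω l - realLambdaN P X S' n l| ≤
        2 * (Cl * (ε n * ε n ^ (1 / (4 * (d : ℝ))))) + ε n * (1 + ε n) / n := by
      rw [abs_le] at *
      constructor <;> linarith
    refine h15.trans ?_
    calc _ = ε n * (2 * Cl * ε n ^ (1 / (4 * (d : ℝ))) + (1 + ε n) / n) := by ring
      _ ≤ ε n * η := by gcongr
      _ = η * ε n := mul_comm _ _
  refine (hfinal hl h9 h6 h14).trans ?_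
  gcongr
  rw [ENNReal.ofReal_mul hη.le]
  gcongr
  -- The error `η ε_n` already suffices; the term in `ξ₁(B)` is only added.
  exact le_self_add
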